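/- Let $K$ be an algebraically closed field of characteristic $0$, let $n\ge 1$, and write $K^*=K\setminus\{0\}$. For Laurent polynomials $f_1,\dots,f_n\in K[x_1^{\pm1},\dots,x_n^{\pm1}]$, let $Z^*_K(F)\subseteq (K^*)^n$ be the set of common zeros of $F=(f_1,\dots,f_n)$ in the torus $(K^*)^n$. The intersection multiplicity of $F$ at $\zeta\in Z^*_K(F)$ is $\dim_K \mathcal O_\zeta/(f_1,\dots,f_n)\mathcal O_\zeta$, where $\mathcal O_\zeta$ is the localization of $K[x_1^{\pm1},\dots,x_n^{\pm1}]$ at the maximal ideal of all Laurent polynomials vanishing at $\zeta$. (1) Let $A\subset\mathbb Z^n$ be a finite set with $\#A\le n+2$ such that no $n+1$ points of $A$ lie in an affine hyperplane of $\mathbb R^n$, and suppose that the exponent vectors of $f_1,\dots,f_n$ all lie in $A$ and that $Z^*_K(F)$ is finite. Then every $\zeta\in Z^*_K(F)$ has intersection multiplicity at most $n+1$ if $\#A=n+2$, and intersection multiplicity exactly $1$ if $\#A=n+1$. (2) Both bounds are sharp, for every such $K$ and every $n\ge1$: for $\#A=n+2$ (respectively $\#A=n+1$) there are $A$ and $F$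 as in (1), where moreover $A\subset\mathbb Z_{\ge0}^n$ (so that the $f_i$ are polynomials), such that some $\zeta\in Z^*_K(F)$ has intersection multiplicity exactly $n+1$ (respectively $1$). -/

import Mathlib

/-- The ring `K[x₁^{±1}, …, xₙ^{±1}]` of Laurent polynomials in `n` variables, as the algebra of the
group `ℤⁿ` of exponent vectors. -/
abbrev LaurentRing (K : Type*) [Field K] (n : ℕ) : Type _ :=
  AddMonoidAlgebra K (Fin n → ℤ)

/-- The character `a ↦ ζ^a = ∏ i, ζ i ^ a i` of `ℤⁿ` given by a point `ζ` of the torus `(K^*)ⁿ`. -/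
def torusCharacter {K : Type*} [Field K] {n : ℕ} (ζ : Fin n → Kˣ) :
    Multiplicative (Fin n → ℤ) →* K where
  toFun a := ((∏ i, ζ i ^ (a.toAdd i) : Kˣ) : K)
  map_one' := by simp
  map_mul' a b := by simp [zpow_add, Finset.prod_mul_distrib]

/-- Evaluation of Laurent polynomials at a point `ζ` of the torus `(K^*)ⁿ`. -/
noncomputable def laurentEval {K : Type*} [Field K] {n : ℕ} (ζ : Fin n → Kˣ) :
    LaurentRing K n →ₐ[K] K :=
  AddMonoidAlgebra.lift K K (Fin n → ℤ) (torusCharacter ζ)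

theorem laurentEval_single {K : Type*} [Field K] {n : ℕ} (ζ : Fin n → Kˣ)
    (a : Fin n → ℤ) (c : K) :
    laurentEval ζ (AddMonoidAlgebra.single a c) = c * ∏ i, (ζ i : K) ^ a i := by
  simp [laurentEval, torusCharacter]

instance isPrime_ker_laurentEval {K : Type*} [Field K] {n : ℕ} (ζ : Fin n → Kˣ) :
    (RingHom.ker (laurentEval ζ)).IsPrime :=
  RingHom.ker_isPrime (laurentEval ζ).toRingHom

/-- The set of roots of the system `F = (f₁, …, fₙ)` in the torus `(K^*)ⁿ`. -/
def torusZeros {K : Type*} [Field K] {n : ℕ} (F : Fin n → LaurentRing K n) :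
    Set (Fin n → Kˣ) :=
  {ζ | ∀ i, laurentEval ζ (F i) = 0}

/-- The local ring of the torus `(K^*)ⁿ` at `ζ`: the localization of the Laurent polynomial ring at
the maximal ideal of all Laurent polynomials vanishing at `ζ`. -/
abbrev TorusLocalRing {K : Type*} [Field K] {n : ℕ} (ζ : Fin n → Kˣ) : Type _ :=
  Localization.AtPrime (RingHom.ker (laurentEval ζ))

/-- The ideal generated by `f₁, …, fₙ` in the local ring at `ζ`. -/
noncomputable def localIdeal {K : Type*} [Field K] {n : ℕ} (F : Fin n → LaurentRing K n)
    (ζ : Fin n → Kˣ) : Ideal (TorusLocalRing ζ) :=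
  Ideal.span (Set.range fun i => algebraMap (LaurentRing K n) (TorusLocalRing ζ) (F i))

/-- The intersection multiplicity of `F = (f₁, …, fₙ)` at `ζ`: the dimension over `K` of
`𝒪_ζ / (f₁, …, fₙ)`, with value `⊤` when this dimension is infinite. -/
noncomputable def intersectionMultiplicity {K : Type*} [Field K] {n : ℕ}
    (F : Fin n → LaurentRing K n) (ζ : Fin n → Kˣ) : ℕ∞ :=
  Cardinal.toENat (Module.rank K (TorusLocalRing ζ ⧸ localIdeal F ζ))

/-- No `n + 1` (distinct) points of `A ⊂ ℤⁿ` lie in an affine hyperplane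
`{x ∈ ℝⁿ | c₁ x₁ + ⋯ + cₙ xₙ = d}`, `c ≠ 0`. -/
def NoPointsInHyperplane {n : ℕ} (A : Finset (Fin n → ℤ)) : Prop :=
  ∀ S ⊆ A, S.card = n + 1 →
    ¬ ∃ (c : Fin n → ℝ) (d : ℝ), c ≠ 0 ∧ ∀ a ∈ S, ∑ i, c i * (a i : ℝ) = d

/-! Let `Q` be the local ring at `ζ` modulo the equations, and `u a` the class of `x^a / ζ^a` in
`Q`. Finiteness of the zero set makes the `n` equations linearly independent (Krull's height
theorem, `linearIndependent_of_finite_torusZeros`). On at most `n + 2` monomials they leave a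
solution space of dimension at most two, and it contains the constant vector. Hence, after
translation by some `a₀ ∈ A`, `u (a - a₀) = 1 + d_a w` with scalars `d_a` and a single `w` in the
maximal ideal (`exists_affine_parametrization`). The vectors `a - a₀` span `ℚⁿ`, so by Nakayama `w`
generates the maximal ideal, and `w ^ k = 0` bounds the dimension of `Q` by `k`.

An integral relation between the `a - a₀` becomes an equation `∏ (1 + d_a w)^p_a = ∏ (1 + d_a
w)^q_a`. Logarithmic derivatives show that a nonzero difference of two such products vanishes at `0`
to order at most the number of factors, here `n + 1` (`exists_linearFormsBinomial_eq`). If every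
relation gave the zero polynomial, the line `t ↦ 1 + d_a t` would lift to infinitely many zeros,
because `K^*` is divisible (`infinite_torusZeros`). With `n + 1` monomials all solutions are
constant and `w = 0`.

For sharpness take `d_k = k`, `0 ≤ k ≤ n + 1`, and the relation with coefficients `(-1)^k * choose
(n + 1) k`. Its power sums vanish up to degree `n`, so the binomial vanishes to order at least `n +
1`, and the jet `x_k = 1 + k t` modulo `t ^ (n + 1)` lies on the system. -/

/-! ### Order of vanishing at `0` of a difference of products of linear forms. -/

section LinearForms

open Polynomial

variable {K ι : Type*} [Field K] (s : Finset ι) (d : ι → K)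

/-- The difference of two products of powers of the linear forms `1 + dᵢ X`. -/
noncomputable def linearFormsBinomial (p q : ι → ℕ) : K[X] :=
  ∏ i ∈ s, (1 + C (d i) * X) ^ p i - ∏ i ∈ s, (1 + C (d i) * X) ^ q i

theorem eval_zero_prod_linearForms_pow (p : ι → ℕ) :
    (∏ i ∈ s, (1 + C (d i) * X) ^ p i).eval 0 = 1 := by
  simp [eval_prod]

theorem isCoprime_X_of_eval_zero_ne_zero {f : K[X]} (hf : f.eval 0 ≠ 0) (k : ℕ) :
    IsCoprime (X ^ k) f := by
  refine IsCoprime.pow_left ((irreducible_X.coprime_iff_not_dvd).2 ?_)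
  rwa [X_dvd_iff, coeff_zero_eq_eval_zero]

theorem linearFormsBinomial_eval_zero (p q : ι → ℕ) :
    (linearFormsBinomial s d p q).eval 0 = 0 := by
  rw [linearFormsBinomial, eval_sub, eval_zero_prod_linearForms_pow,
    eval_zero_prod_linearForms_pow, sub_self]

theorem X_pow_dvd_of_X_pow_dvd_derivative [CharZero K] {f : K[X]} (h0 : f.eval 0 = 0) {k : ℕ}
    (h : X ^ k ∣ derivative f) : X ^ (k + 1) ∣ f := by
  rw [X_pow_dvd_iff] at h ⊢
  intro m hm
  rcases m with _ | m
  · rwa [coeff_zero_eq_eval_zero]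
  · have := h m (by omega)
    rw [coeff_derivative] at this
    exact (mul_eq_zero.1 this).resolve_right (by exact_mod_cast Nat.succ_ne_zero m)

/-- The sum `∑ pᵢ dᵢ ∏_{j ≠ i} (1 + d_j X)`, that is, the logarithmic derivative of
`∏ (1 + dᵢ X) ^ pᵢ` multiplied by `∏ (1 + dᵢ X)`. -/
noncomputable def logDerivNumerator [DecidableEq ι] (p : ι → ℕ) : K[X] :=
  ∑ i ∈ s, ((p i : K[X]) * C (d i)) * ∏ j ∈ s.erase i, (1 + C (d j) * X)

variable [DecidableEq ι]

theorem prod_mul_derivative_prod_pow (p : ι → ℕ) :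
    (∏ i ∈ s, (1 + C (d i) * X)) * derivative (∏ i ∈ s, (1 + C (d i) * X) ^ p i) =
      (∏ i ∈ s, (1 + C (d i) * X) ^ p i) * logDerivNumerator s d p := by
  rw [derivative_prod_finset, logDerivNumerator, Finset.mul_sum, Finset.mul_sum]
  refine Finset.sum_congr rfl fun i hi => ?_
  rw [← Finset.mul_prod_erase s (fun i => 1 + C (d i) * X) hi,
    ← Finset.mul_prod_erase s (fun i => (1 + C (d i) * X) ^ p i) hi]
  rcases Nat.eq_zero_or_pos (p i) with h | h
  · simp [h]
  · obtain ⟨m, hm⟩ := Nat.exists_eq_succ_of_ne_zero h.ne'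
    simp only [hm, derivative_pow, derivative_add, derivative_one, derivative_mul, derivative_C,
      derivative_X]
    simp only [Nat.succ_eq_add_one, Nat.add_sub_cancel, map_natCast]
    ring

theorem natDegree_logDerivNumerator_le (p : ι → ℕ) :
    (logDerivNumerator s d p).natDegree ≤ s.card - 1 := by
  refine natDegree_sum_le_of_forall_le _ _ fun i hi => ?_
  refine natDegree_mul_le.trans ?_
  have h1 : ((p i : K[X]) * C (d i)).natDegree = 0 := by
    rw [← C_eq_natCast, ← C_mul, natDegree_C]
  rw [h1, zero_add, ← Finset.card_erase_of_mem hi]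
  refine (natDegree_prod_le _ _).trans ?_
  refine (Finset.sum_le_card_nsmul _ _ 1 fun j _ => ?_).trans (by simp)
  compute_degree

theorem prod_mul_derivative_linearFormsBinomial (p q : ι → ℕ) :
    (∏ i ∈ s, (1 + C (d i) * X)) * derivative (linearFormsBinomial s d p q) =
      linearFormsBinomial s d p q * logDerivNumerator s d p +
      (∏ i ∈ s, (1 + C (d i) * X) ^ q i) *
        (logDerivNumerator s d p - logDerivNumerator s d q) := by
  rw [linearFormsBinomial, derivative_sub, mul_sub, prod_mul_derivative_prod_pow,
    prod_mul_derivative_prod_pow]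
  ring

variable [CharZero K]

/-- The quotient of the two products has value `1` at `0`. In characteristic zero, its difference
from `1` vanishes to order `k + 1` exactly when its logarithmic derivative vanishes to order `k`. -/
theorem X_pow_dvd_linearFormsBinomial_iff (p q : ι → ℕ) (k : ℕ) :
    X ^ (k + 1) ∣ linearFormsBinomial s d p q ↔
      X ^ k ∣ logDerivNumerator s d p - logDerivNumerator s d q := by
  have key := prod_mul_derivative_linearFormsBinomial s d p q
  have hD : IsCoprime (X ^ k) (∏ i ∈ s, (1 + C (d i) * X)) :=
    isCoprime_X_of_eval_zero_ne_zero (by simp [eval_prod]) k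
  have hG : IsCoprime (X ^ k) (∏ i ∈ s, (1 + C (d i) * X) ^ q i) :=
    isCoprime_X_of_eval_zero_ne_zero (by simp [eval_prod]) k
  constructor
  · intro h
    refine hG.dvd_of_dvd_mul_left ?_
    rw [← sub_eq_of_eq_add' key]
    refine dvd_sub (Dvd.dvd.mul_left ?_ _)
      (Dvd.dvd.mul_right ((pow_dvd_pow X k.le_succ).trans h) _)
    obtain ⟨g, hg⟩ := h
    rw [hg, derivative_mul, derivative_X_pow]
    simp only [Nat.add_sub_cancel]
    exact dvd_add (Dvd.intro_left _ (by ring : (C ((k + 1 : ℕ) : K) * g) * X ^ k = _))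
      (Dvd.intro_left _ (by ring : X * derivative g * X ^ k = _))
  · intro h
    -- The identity `key` also contains the binomial itself, whose divisibility by the smaller power
    -- comes from the induction.
    induction k with
    | zero => simpa [X_dvd_iff, coeff_zero_eq_eval_zero] using
        linearFormsBinomial_eval_zero s d p q
    | succ k ih =>
      have hk := ih (isCoprime_X_of_eval_zero_ne_zero (by simp [eval_prod]) k)
        (isCoprime_X_of_eval_zero_ne_zero (by simp [eval_prod]) k)
        ((pow_dvd_pow X k.le_succ).trans h)
      refine X_pow_dvd_of_X_pow_dvd_derivative (linearFormsBinomial_eval_zero s d p q)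
        (hD.dvd_of_dvd_mul_left ?_)
      rw [key]
      exact dvd_add (hk.mul_right _) (h.mul_left _)

/-- The difference of the logarithmic numerators has degree below `s.card`. A larger order of
vanishing would make it zero, and then every power of `X` divides the binomial. -/
theorem exists_linearFormsBinomial_eq (p q : ι → ℕ)
    (h : linearFormsBinomial s d p q ≠ 0) :
    ∃ k ≤ s.card, ∃ g : K[X], g.eval 0 ≠ 0 ∧ linearFormsBinomial s d p q = X ^ k * g := by
  have hs : s.Nonempty := by
    by_contra hs
    rw [Finset.not_nonempty_iff_eq_empty] at hs
    simp [linearFormsBinomial, hs] at h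
  obtain ⟨g, hg, hg'⟩ := exists_eq_pow_rootMultiplicity_mul_and_not_dvd _ h 0
  rw [C_0, sub_zero] at hg hg'
  refine ⟨_, ?_, g, ?_, hg⟩
  · by_contra! hlt
    refine h ?_
    have h1 : X ^ (s.card + 1) ∣ linearFormsBinomial s d p q :=
      (pow_dvd_pow X hlt).trans ⟨g, hg⟩
    have h2 := (X_pow_dvd_linearFormsBinomial_iff s d p q _).1 h1
    have h3 : logDerivNumerator s d p - logDerivNumerator s d q = 0 := by
      by_contra h4
      have h5 := natDegree_le_of_dvd h2 h4
      have h6 := natDegree_sub_le_of_le (natDegree_logDerivNumerator_le s d p)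
        (natDegree_logDerivNumerator_le s d q)
      rw [natDegree_X_pow] at h5
      have := hs.card_pos
      simp only [max_self] at h6
      omega
    by_contra h4
    have h5 := natDegree_le_of_dvd
      ((X_pow_dvd_linearFormsBinomial_iff s d p q (linearFormsBinomial s d p q).natDegree).2
        (h3 ▸ dvd_zero _)) h4
    rw [natDegree_X_pow] at h5
    omega
  · rwa [X_dvd_iff, coeff_zero_eq_eval_zero] at hg'

end LinearForms

/-! ### Local algebras whose maximal ideal is generated by one nilpotent element. -/

section LocalAlgebra

open IsLocalRing

variable {K Q : Type*} [Field K] [CommRing Q] [Algebra K Q]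

/-- Iterating `h` expands every element in powers of `w`, and the expansion stops at `w ^ k = 0`. -/
theorem rank_le_of_isNilpotent_generator (w : Q) (k : ℕ) (hw : w ^ k = 0)
    (h : ∀ q : Q, ∃ (c : K) (r : Q), q = algebraMap K Q c + w * r) :
    Module.rank K Q ≤ k := by
  have key : ∀ (j : ℕ) (q : Q), ∃ (c : Fin j → K) (r : Q), q = ∑ i, c i • w ^ (i : ℕ) + w ^ j * r := by
    intro j
    induction j with
    | zero => exact fun q => ⟨Fin.elim0, q, by simp⟩
    | succ j ih =>
      intro q
      obtain ⟨c, r, hr⟩ := ih q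
      obtain ⟨c', r', hr'⟩ := h r
      refine ⟨Fin.snoc c c', r', ?_⟩
      rw [Fin.sum_univ_castSucc]
      simp only [Fin.snoc_castSucc, Fin.snoc_last, Fin.val_castSucc, Fin.val_last]
      rw [hr, hr', Algebra.smul_def c']
      ring
  have htop : Submodule.span K (Set.range fun i : Fin k => w ^ (i : ℕ)) = ⊤ := by
    refine Submodule.eq_top_iff'.2 fun q => ?_
    obtain ⟨c, r, hr⟩ := key k q
    rw [hr, hw, zero_mul, add_zero]
    exact Submodule.sum_mem _ fun i _ => Submodule.smul_mem _ _ (Submodule.subset_span ⟨i, rfl⟩)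
  calc Module.rank K Q = Module.rank K (⊤ : Submodule K Q) := (rank_top K Q).symm
    _ ≤ k := by
      rw [← htop]
      refine (rank_span_le _).trans ?_
      simpa using Cardinal.mk_range_le_lift (f := fun i : Fin k => w ^ (i : ℕ))

/-- The value of `g` at `w` is a nonzero constant modulo the maximal ideal, hence a unit that
cancels. -/
theorem pow_eq_zero_of_aeval_eq_zero [IsLocalRing Q] {w : Q} (hw : w ∈ maximalIdeal Q)
    {g : Polynomial K} (hg : g.eval 0 ≠ 0) {k : ℕ}
    (h : Polynomial.aeval w (Polynomial.X ^ k * g) = 0) : w ^ k = 0 := by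
  have hu : IsUnit (Polynomial.aeval w g) := by
    by_contra hn
    have h1 : Polynomial.aeval w g ∈ maximalIdeal Q := hn
    obtain ⟨g', hg'⟩ : Polynomial.X ∣ g - Polynomial.C (g.eval 0) := by
      rw [Polynomial.X_dvd_iff, Polynomial.coeff_zero_eq_eval_zero]
      simp
    rw [sub_eq_iff_eq_add] at hg'
    rw [hg', map_add, map_mul, Polynomial.aeval_X, Polynomial.aeval_C] at h1
    have h2 := (Ideal.add_mem_iff_right _ (Ideal.mul_mem_right _ _ hw)).1 h1
    exact h2 ((IsUnit.mk0 _ hg).map (algebraMap K Q))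
  rw [map_mul, map_pow, Polynomial.aeval_X] at h
  exact hu.mul_left_eq_zero.1 h

/-- If a property of elements of `ℤⁿ` is closed under subtraction and division by integers, and
holds on a subset of full rank, then it holds everywhere. -/
theorem AddSubgroup.eq_top_of_saturated {n : ℕ} (H : AddSubgroup (Fin n → ℤ))
    (hsat : ∀ (N : ℤ) (a : Fin n → ℤ), N ≠ 0 → N • a ∈ H → a ∈ H) (s : Set (Fin n → ℤ))
    (hs : s ⊆ H) (hspan : ∀ f : (Fin n → ℚ) →ₗ[ℚ] ℚ, (∀ a ∈ s, f (fun i => (a i : ℚ)) = 0) → f = 0) :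
    H = ⊤ := by
  have htop : Submodule.span ℚ ((fun (a : Fin n → ℤ) i => (a i : ℚ)) '' s) = ⊤ := by
    by_contra hne
    obtain ⟨f, hf, hle⟩ := Submodule.exists_le_ker_of_lt_top _ (lt_top_iff_ne_top.2 hne)
    exact hf (hspan f fun a ha => hle (Submodule.subset_span ⟨a, ha, rfl⟩))
  -- Clearing denominators puts a nonzero integer multiple of each vector of the span into `H`.
  have key : ∀ v ∈ Submodule.span ℚ ((fun (a : Fin n → ℤ) i => (a i : ℚ)) '' s),
      ∃ N : ℤ, N ≠ 0 ∧ ∃ h ∈ H, ∀ i, (N : ℚ) * v i = (h i : ℚ) := by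
    intro v hv
    induction hv using Submodule.span_induction with
    | mem x hx =>
      obtain ⟨a, ha, rfl⟩ := hx
      exact ⟨1, one_ne_zero, a, hs ha, fun i => by simp⟩
    | zero => exact ⟨1, one_ne_zero, 0, H.zero_mem, fun i => by simp⟩
    | add x y _ _ hx hy =>
      obtain ⟨N, hN, a, ha, hx⟩ := hx
      obtain ⟨M, hM, b, hb, hy⟩ := hy
      refine ⟨N * M, mul_ne_zero hN hM, M • a + N • b,
        H.add_mem (H.zsmul_mem ha _) (H.zsmul_mem hb _), fun i => ?_⟩
      simp only [Pi.add_apply, Pi.smul_apply, smul_eq_mul]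
      push_cast
      rw [← hx, ← hy]
      ring
    | smul c x _ hx =>
      obtain ⟨N, hN, a, ha, hx⟩ := hx
      refine ⟨N * c.den, mul_ne_zero hN (by exact_mod_cast c.den_ne_zero), c.num • a,
        H.zsmul_mem ha _, fun i => ?_⟩
      simp only [Pi.smul_apply, smul_eq_mul]
      push_cast
      rw [← hx, ← Rat.mul_den_eq_num c]
      ring
  refine eq_top_iff.2 fun a _ => ?_
  obtain ⟨N, hN, h, hh, heq⟩ := key (fun i => (a i : ℚ)) (htop ▸ Submodule.mem_top)
  refine hsat N a hN ?_
  convert hh using 1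
  ext i
  have := heq i
  simp only [Pi.smul_apply, smul_eq_mul]
  exact_mod_cast this

variable [IsLocalRing Q] [IsNoetherianRing Q] [CharZero K] {n : ℕ}

/-- Modulo the square of the maximal ideal, `a ↦ u a - 1` is additive. On `s` it takes values in
`(w)`, and `s` spans rationally, so it does so everywhere. -/
theorem maximalIdeal_eq_span_singleton_of_characters
    (u : Multiplicative (Fin n → ℤ) →* Q)
    (hm : maximalIdeal Q = Ideal.span (Set.range fun a => u a - 1))
    (s : Set (Fin n → ℤ))
    (hspan : ∀ f : (Fin n → ℚ) →ₗ[ℚ] ℚ, (∀ a ∈ s, f (fun i => (a i : ℚ)) = 0) → f = 0)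
    (d : (Fin n → ℤ) → K) (w : Q) (hw : w ∈ maximalIdeal Q)
    (hu : ∀ a ∈ s, u (Multiplicative.ofAdd a) = 1 + algebraMap K Q (d a) * w) :
    maximalIdeal Q = Ideal.span {w} := by
  have hmem : ∀ a, u a - 1 ∈ maximalIdeal Q := fun a => hm ▸ Ideal.subset_span ⟨a, rfl⟩
  refine le_antisymm ?_ (by simpa [Ideal.span_le] using hw)
  -- Nakayama: it suffices to work modulo the square of the maximal ideal.
  refine Submodule.le_of_le_smul_of_le_jacobson_bot (IsNoetherian.noetherian _)
    (maximalIdeal_le_jacobson _) ?_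
  set J : Ideal Q := Ideal.span {w} ⊔ maximalIdeal Q • maximalIdeal Q with hJ
  have hsq : ∀ x ∈ maximalIdeal Q, ∀ y ∈ maximalIdeal Q, x * y ∈ J := fun x hx y hy =>
    (le_sup_right : maximalIdeal Q • maximalIdeal Q ≤ J) (Ideal.mul_mem_mul hx hy)
  have hadd : ∀ a b, u (a * b) - 1 - ((u a - 1) + (u b - 1)) ∈ J := fun a b => by
    have := hsq _ (hmem a) _ (hmem b)
    rw [map_mul]
    convert this using 1
    ring
  -- the additive map `a ↦ u a - 1` modulo `J`
  let e : (Fin n → ℤ) →+ Q ⧸ J :=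
    { toFun := fun a => Ideal.Quotient.mk J (u (Multiplicative.ofAdd a) - 1)
      map_zero' := by simp
      map_add' := fun a b => by
        rw [← map_add, Ideal.Quotient.eq]
        exact hadd _ _ }
  have he : ∀ a, e a = Ideal.Quotient.mk J (u (Multiplicative.ofAdd a) - 1) := fun a => rfl
  have htop : e.ker = ⊤ := by
    refine AddSubgroup.eq_top_of_saturated _ (fun N a hN ha => ?_) s (fun a ha => ?_) hspan
    · rw [AddMonoidHom.mem_ker] at ha ⊢
      rw [map_zsmul, zsmul_eq_mul] at ha
      -- Characteristic zero makes nonzero integers invertible, so the kernel is saturated.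
      have hunit : IsUnit ((N : K)) := IsUnit.mk0 _ (by exact_mod_cast hN)
      have := hunit.map (algebraMap K (Q ⧸ J))
      rw [map_intCast] at this
      exact this.mul_right_eq_zero.1 ha
    · rw [SetLike.mem_coe, AddMonoidHom.mem_ker, he, hu a ha, Ideal.Quotient.eq_zero_iff_mem,
        add_sub_cancel_left]
      exact Ideal.mul_mem_left _ _
        ((le_sup_left : Ideal.span {w} ≤ J) (Ideal.subset_span rfl))
  rw [hm, Ideal.span_le]
  rintro _ ⟨a, rfl⟩
  have : Multiplicative.toAdd a ∈ e.ker := htop ▸ AddSubgroup.mem_top _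
  rw [AddMonoidHom.mem_ker, he, Ideal.Quotient.eq_zero_iff_mem] at this
  exact this

theorem rank_le_of_characters
    (hK : ∀ q : Q, ∃ c : K, q - algebraMap K Q c ∈ maximalIdeal Q)
    (u : Multiplicative (Fin n → ℤ) →* Q)
    (hm : maximalIdeal Q = Ideal.span (Set.range fun a => u a - 1))
    (s : Set (Fin n → ℤ))
    (hspan : ∀ f : (Fin n → ℚ) →ₗ[ℚ] ℚ, (∀ a ∈ s, f (fun i => (a i : ℚ)) = 0) → f = 0)
    (d : (Fin n → ℤ) → K) (w : Q) (hw : w ∈ maximalIdeal Q)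
    (hu : ∀ a ∈ s, u (Multiplicative.ofAdd a) = 1 + algebraMap K Q (d a) * w)
    (k : ℕ) (hk : w ^ k = 0) : Module.rank K Q ≤ k := by
  refine rank_le_of_isNilpotent_generator w k hk fun q => ?_
  obtain ⟨c, hc⟩ := hK q
  rw [maximalIdeal_eq_span_singleton_of_characters u hm s hspan d w hw hu,
    Ideal.mem_span_singleton'] at hc
  obtain ⟨r, hr⟩ := hc
  exact ⟨c, r, by rw [mul_comm, hr]; ring⟩

omit [IsNoetherianRing Q] [CharZero K] [IsLocalRing Q] in
/-- An integral relation between exponent vectors gives a polynomial equation for `w`. -/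
theorem aeval_linearFormsBinomial_eq_zero
    (u : Multiplicative (Fin n → ℤ) →* Q) (s : Finset (Fin n → ℤ)) (d : (Fin n → ℤ) → K) (w : Q)
    (hu : ∀ a ∈ s, u (Multiplicative.ofAdd a) = 1 + algebraMap K Q (d a) * w)
    (p q : (Fin n → ℤ) → ℕ) (h : ∑ a ∈ s, p a • a = ∑ a ∈ s, q a • a) :
    Polynomial.aeval w (linearFormsBinomial s d p q) = 0 := by
  have key : ∀ p : (Fin n → ℤ) → ℕ, Polynomial.aeval w
      (∏ a ∈ s, (1 + Polynomial.C (d a) * Polynomial.X) ^ p a) =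
        u (Multiplicative.ofAdd (∑ a ∈ s, p a • a)) := by
    intro p
    rw [ofAdd_sum, map_prod, map_prod]
    refine Finset.prod_congr rfl fun a ha => ?_
    rw [ofAdd_nsmul, map_pow, map_pow, hu a ha]
    simp
  rw [linearFormsBinomial, map_sub, key, key, h, sub_self]

end LocalAlgebra

/-! ### Laurent polynomial rings: points, heights and independence of the equations. -/

section LaurentRing

variable {K : Type*} [Field K] {n : ℕ} {B : Type*} [CommRing B] [Algebra K B]

/-- The monomial `x ^ a` as a unit of the Laurent polynomial ring. -/
noncomputable def laurentUnit (K : Type*) [Field K] {n : ℕ} :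
    Multiplicative (Fin n → ℤ) →* (LaurentRing K n)ˣ :=
  (AddMonoidAlgebra.of K (Fin n → ℤ)).toHomUnits

theorem coe_laurentUnit (a : Multiplicative (Fin n → ℤ)) :
    (laurentUnit K a : LaurentRing K n) = AddMonoidAlgebra.single a.toAdd 1 := rfl

/-- The coordinate function `xᵢ` as a unit of the Laurent polynomial ring. -/
noncomputable def laurentCoord (K : Type*) [Field K] {n : ℕ} (i : Fin n) : (LaurentRing K n)ˣ :=
  laurentUnit K (.ofAdd (Pi.single i 1))

theorem laurentUnit_eq_prod (a : Fin n → ℤ) :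
    laurentUnit K (.ofAdd a) = ∏ i, laurentCoord K i ^ a i := by
  conv_lhs => rw [← Finset.univ_sum_single a, ofAdd_sum, map_prod]
  refine Finset.prod_congr rfl fun i _ => ?_
  rw [laurentCoord, ← map_zpow, ← ofAdd_zsmul, ← Pi.single_smul, smul_eq_mul, mul_one]

theorem laurentAlgHom_single (φ : LaurentRing K n →ₐ[K] B) (a : Fin n → ℤ) :
    φ (AddMonoidAlgebra.single a 1) =
      ((∏ i, Units.map (φ : LaurentRing K n →* B) (laurentCoord K i) ^ a i : Bˣ) : B) := by
  have : AddMonoidAlgebra.single a 1 = (laurentUnit K (.ofAdd a) : LaurentRing K n) := rfl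
  simp_rw [← map_zpow, ← map_prod]
  rw [this, laurentUnit_eq_prod]
  rfl

theorem laurentAlgHom_ext {φ ψ : LaurentRing K n →ₐ[K] B}
    (h : ∀ i : Fin n, φ (laurentCoord K i : LaurentRing K n) =
      ψ (laurentCoord K i : LaurentRing K n)) : φ = ψ := by
  refine AddMonoidAlgebra.algHom_ext (fun a => ?_) (by ext)
  rw [laurentAlgHom_single, laurentAlgHom_single]
  exact congrArg Units.val (Finset.prod_congr rfl fun i _ =>
    congrArg (· ^ a i) (Units.ext (h i)))

/-- The algebra homomorphism from the Laurent polynomial ring sending `xᵢ` to the unit `b i`. -/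
noncomputable def laurentLift (K : Type*) [Field K] {n : ℕ} {B : Type*} [CommRing B] [Algebra K B]
    (b : Fin n → Bˣ) : LaurentRing K n →ₐ[K] B :=
  AddMonoidAlgebra.lift K B (Fin n → ℤ)
    { toFun := fun a => ((∏ i, b i ^ (a.toAdd i) : Bˣ) : B)
      map_one' := by simp
      map_mul' := fun a a' => by simp [zpow_add, Finset.prod_mul_distrib] }

theorem laurentLift_single (b : Fin n → Bˣ) (a : Fin n → ℤ) (c : K) :
    laurentLift K b (AddMonoidAlgebra.single a c) = c • ((∏ i, b i ^ a i : Bˣ) : B) := by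
  simp [laurentLift]

theorem laurentLift_coord (b : Fin n → Bˣ) (i : Fin n) :
    laurentLift K b (laurentCoord K i) = b i := by
  rw [laurentCoord, coe_laurentUnit, laurentLift_single, one_smul]
  congr 1
  rw [Finset.prod_eq_single i]
  · simp
  · intro j _ hj
    simp [Pi.single_eq_of_ne hj]
  · simp

theorem laurentEval_eq_lift (ζ : Fin n → Kˣ) : laurentEval ζ = laurentLift K ζ := rfl

theorem laurentEval_coord (ζ : Fin n → Kˣ) (i : Fin n) :
    laurentEval ζ (laurentCoord K i) = ζ i := by
  rw [laurentEval_eq_lift, laurentLift_coord]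

theorem exists_eq_laurentEval (φ : LaurentRing K n →ₐ[K] K) :
    ∃ ζ : Fin n → Kˣ, φ = laurentEval ζ :=
  ⟨fun i => Units.map (φ : LaurentRing K n →* K) (laurentCoord K i),
    laurentAlgHom_ext fun i => by rw [laurentEval_coord]; rfl⟩

theorem laurentEval_surjective (ζ : Fin n → Kˣ) : Function.Surjective (laurentEval ζ) :=
  fun c => ⟨algebraMap K _ c, by rw [AlgHom.commutes]; rfl⟩

instance isMaximal_ker_laurentEval (ζ : Fin n → Kˣ) :
    (RingHom.ker (laurentEval ζ)).IsMaximal :=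
  RingHom.ker_isMaximal_of_surjective _ (laurentEval_surjective ζ)

instance isNoetherianRing_laurentRing : IsNoetherianRing (LaurentRing K n) :=
  Algebra.FiniteType.isNoetherianRing K _

/-- Nullstellensatz for the torus: the residue field is finite over `K`, hence equal to `K`. -/
theorem exists_ker_laurentEval_eq [IsAlgClosed K] (M : Ideal (LaurentRing K n)) [M.IsMaximal] :
    ∃ ζ : Fin n → Kˣ, M = RingHom.ker (laurentEval ζ) := by
  let := Ideal.Quotient.field M
  have : Module.Finite K (LaurentRing K n ⧸ M) :=
    finite_of_finite_type_of_isJacobsonRing K _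
  let e : K ≃ₐ[K] LaurentRing K n ⧸ M := AlgEquiv.ofBijective (Algebra.ofId K _)
    IsAlgClosed.algebraMap_bijective_of_isIntegral
  obtain ⟨ζ, hζ⟩ := exists_eq_laurentEval ((e.symm : _ →ₐ[K] K).comp (Ideal.Quotient.mkₐ K M))
  refine ⟨ζ, ?_⟩
  rw [← hζ]
  ext x
  simp [RingHom.mem_ker, Ideal.Quotient.eq_zero_iff_mem]

/-- The substitution `xᵢ ↦ ζᵢ` for `i < k`, fixing the other coordinates. -/
noncomputable def partialEval (ζ : Fin n → Kˣ) (k : ℕ) : LaurentRing K n →ₐ[K] LaurentRing K n :=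
  laurentLift K fun i => if (i : ℕ) < k then Units.map (algebraMap K (LaurentRing K n)) (ζ i) else
    laurentCoord K i

theorem partialEval_coord (ζ : Fin n → Kˣ) (k : ℕ) (i : Fin n) :
    partialEval ζ k (laurentCoord K i) =
      if (i : ℕ) < k then algebraMap K (LaurentRing K n) (ζ i) else laurentCoord K i := by
  rw [partialEval, laurentLift_coord]
  split_ifs <;> rfl

/-- Fixing one more coordinate strictly enlarges the prime kernel, so the height grows by at least
one at each step. -/
theorem le_height_ker_partialEval (ζ : Fin n → Kˣ) (k : ℕ) (hk : k ≤ n) :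
    (k : ℕ∞) ≤ (RingHom.ker (partialEval ζ k)).height := by
  induction k with
  | zero => simp
  | succ k ih =>
    have h1 := ih (by omega)
    have hp : ∀ k, (RingHom.ker (partialEval ζ k)).IsPrime := fun k =>
      RingHom.ker_isPrime (partialEval ζ k).toRingHom
    have := hp k
    have := hp (k + 1)
    have hlt : RingHom.ker (partialEval ζ k) < RingHom.ker (partialEval ζ (k + 1)) := by
      have hcomp : (partialEval ζ (k + 1)).comp (partialEval ζ k) = partialEval ζ (k + 1) := by
        refine laurentAlgHom_ext fun i => ?_
        rw [AlgHom.comp_apply, partialEval_coord]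
        split_ifs with h
        · rw [AlgHom.commutes, partialEval_coord, if_pos (by omega)]
        · rfl
      refine lt_of_le_of_ne (fun x hx => ?_) fun heq => ?_
      · rw [RingHom.mem_ker] at hx ⊢
        rw [← hcomp, AlgHom.comp_apply, hx, map_zero]
      · let i : Fin n := ⟨k, hk⟩
        have h2 : (laurentCoord K i : LaurentRing K n) - algebraMap K _ (ζ i : K) ∈
            RingHom.ker (partialEval ζ (k + 1)) := by
          rw [RingHom.mem_ker, map_sub, partialEval_coord, AlgHom.commutes,
            if_pos (by simp [i]), sub_self]
        rw [← heq, RingHom.mem_ker, map_sub, partialEval_coord, AlgHom.commutes,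
            if_neg (by simp [i]), sub_eq_zero] at h2
        -- The coefficient of the coordinate is `1` on the left, and `0` on the right, which is a
        -- constant.
        have h3 := congrArg (fun f : LaurentRing K n => f.coeff (Pi.single i 1)) h2
        simp [laurentCoord, coe_laurentUnit, AddMonoidAlgebra.coe_algebraMap] at h3
    push_cast
    exact (add_le_add_left h1 1).trans (Ideal.height_add_one_le_of_lt_of_isPrime hlt)

theorem le_height_ker_laurentEval (ζ : Fin n → Kˣ) :
    (n : ℕ∞) ≤ (RingHom.ker (laurentEval ζ)).height := by
  refine (le_height_ker_partialEval ζ n le_rfl).trans_eq ?_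
  have : partialEval ζ n = (Algebra.ofId K (LaurentRing K n)).comp (laurentEval ζ) := by
    refine laurentAlgHom_ext fun i => ?_
    rw [partialEval_coord, if_pos i.2, AlgHom.comp_apply, laurentEval_coord]
    rfl
  congr 1
  ext x
  rw [this, RingHom.mem_ker, RingHom.mem_ker, AlgHom.comp_apply]
  exact map_eq_zero_iff _ (algebraMap K (LaurentRing K n)).injective

/-- A system of `n` Laurent polynomials with a nonempty finite set of zeros in the torus is linearly
independent. -/
theorem linearIndependent_of_finite_torusZeros [IsAlgClosed K] (F : Fin n → LaurentRing K n)
    (hfin : (torusZeros F).Finite) (ζ : Fin n → Kˣ) (hζ : ζ ∈ torusZeros F) :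
    LinearIndependent K F := by
  classical
  rw [linearIndependent_iff_notMem_span]
  intro i hi
  -- A dependent equation is redundant, so fewer than `n` generators cut out the same zeros.
  set T : Set (LaurentRing K n) := F '' (Set.univ \ {i}) with hT
  have hFT : ∀ j, F j ∈ Ideal.span T := by
    intro j
    by_cases hj : j = i
    · exact hj ▸ Submodule.span_le_restrictScalars K (LaurentRing K n) T hi
    · exact Ideal.subset_span ⟨j, ⟨trivial, hj⟩, rfl⟩
  have hle : Ideal.span T ≤ RingHom.ker (laurentEval ζ) := by
    rw [Ideal.span_le]
    rintro _ ⟨j, -, rfl⟩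
    exact hζ j
  obtain ⟨p, hp, hpm⟩ := Ideal.exists_minimalPrimes_le hle
  have hpp := hp.isPrime
  have : IsJacobsonRing (LaurentRing K n) := isJacobsonRing_of_finiteType (A := K)
  have hpeq : p = RingHom.ker (laurentEval ζ) := by
    -- In a Jacobson ring `p` is the intersection of the maximal ideals above it. These correspond
    -- to zeros of `F`, hence are finitely many, and a prime that contains a finite intersection
    -- contains one of its members.
    have hjac : (⨅ ξ ∈ hfin.toFinset.filter fun ξ => p ≤ RingHom.ker (laurentEval ξ),
        RingHom.ker (laurentEval ξ)) ≤ p := by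
      conv_rhs => rw [← (isJacobsonRing_iff_prime_eq.1 inferInstance p hpp :
        p.jacobson = p)]
      rw [Ideal.jacobson]
      refine le_sInf fun M ⟨hM, hMmax⟩ => ?_
      obtain ⟨ξ, rfl⟩ := exists_ker_laurentEval_eq M
      refine iInf₂_le ξ ?_
      simp only [Finset.mem_filter, Set.Finite.mem_toFinset]
      exact ⟨fun j => hM (hp.le (hFT j)), hM⟩
    rw [← Finset.inf_eq_iInf, Ideal.IsPrime.inf_le' hpp] at hjac
    obtain ⟨ξ, hξ, hξp⟩ := hjac
    have h1 : p = RingHom.ker (laurentEval ξ) := le_antisymm (Finset.mem_filter.1 hξ).2 hξp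
    rw [h1] at hpm ⊢
    exact (isMaximal_ker_laurentEval ξ).eq_of_le Ideal.IsPrime.ne_top' hpm
  have hTfin : T.Finite := Set.toFinite _
  -- Krull: the point has height at least `n`, yet is minimal over at most `n - 1` generators.
  have h1 := (le_height_ker_laurentEval ζ).trans
    (hpeq ▸ Ideal.height_le_card_of_mem_minimalPrimes_span hTfin hp)
  have h2 : T.ncard ≤ n - 1 := by
    refine (Set.ncard_image_le (Set.toFinite _)).trans ?_
    rw [Set.ncard_sdiff (Set.subset_univ _)]
    simp
  have h3 : n ≤ T.ncard := by exact_mod_cast h1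
  have := i.pos
  omega

end LaurentRing

/-! ### Points of the torus with prescribed monomial values, and families of zeros. -/

section TorusPoints

variable {K : Type*} [Field K] {n : ℕ}

/-- The character `a ↦ ζ ^ a` with values in `K^*`. -/
def torusPow (ζ : Fin n → Kˣ) : Multiplicative (Fin n → ℤ) →* Kˣ where
  toFun a := ∏ i, ζ i ^ (a.toAdd i)
  map_one' := by simp
  map_mul' a b := by simp [zpow_add, Finset.prod_mul_distrib]

theorem laurentEval_single_eq_torusPow (ζ : Fin n → Kˣ) (a : Fin n → ℤ) (c : K) :
    laurentEval ζ (AddMonoidAlgebra.single a c) = c * torusPow ζ (.ofAdd a) := by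
  rw [laurentEval_eq_lift, laurentLift_single]
  rfl

theorem laurentRing_eq_sum {f : LaurentRing K n} {A : Finset (Fin n → ℤ)}
    (hf : f.coeff.support ⊆ A) :
    f = ∑ a ∈ A, AddMonoidAlgebra.single a (f.coeff a) := by
  refine AddMonoidAlgebra.coeff_injective ?_
  rw [AddMonoidAlgebra.coeff_sum]
  simp only [AddMonoidAlgebra.coeff_single]
  conv_lhs => rw [← Finsupp.sum_single f.coeff]
  exact Finsupp.sum_of_support_subset _ hf _ (by simp)

theorem laurentEval_eq_sum (ζ : Fin n → Kˣ) {f : LaurentRing K n} {A : Finset (Fin n → ℤ)}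
    (hf : f.coeff.support ⊆ A) :
    laurentEval ζ f = ∑ a ∈ A, f.coeff a * torusPow ζ (.ofAdd a) := by
  conv_lhs => rw [laurentRing_eq_sum hf, map_sum]
  simp only [laurentEval_single_eq_torusPow]

/-- Roots exist in `K^*`, so it is divisible, hence injective over `ℤ`: characters of a subgroup of
`ℤⁿ` extend to `ℤⁿ`. -/
theorem baer_units_of_isAlgClosed [IsAlgClosed K] : Module.Baer ℤ (Additive Kˣ) := by
  have h : ∀ {m : ℕ}, m ≠ 0 → Function.Surjective fun a : Kˣ => a ^ m := by
    intro m hm y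
    obtain ⟨z, hz⟩ := IsAlgClosed.exists_pow_nat_eq (y : K) (Nat.pos_of_ne_zero hm)
    have hz0 : z ≠ 0 := by
      rintro rfl
      rw [zero_pow hm] at hz
      exact y.ne_zero hz.symm
    exact ⟨Units.mk0 z hz0, Units.ext hz⟩
  let : RootableBy Kˣ ℕ := rootableByOfPowLeftSurj _ _ h
  let : RootableBy Kˣ ℤ := Group.rootableByIntOfRootableByNat _
  let : DivisibleBy (Additive Kˣ) ℤ :=
    { div := fun a m => .ofMul (RootableBy.root a.toMul m)
      div_zero := fun a => RootableBy.root_zero (α := ℤ) a.toMul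
      div_cancel := fun a hm => RootableBy.root_cancel (α := ℤ) a.toMul hm }
  exact Module.Baer.of_divisible _

/-- A system of binomial equations on the torus over an algebraically closed field is solvable if it
is compatible with the integral relations between the exponent vectors. -/
theorem exists_torusPow_eq [IsAlgClosed K] (D : Finset (Fin n → ℤ)) (y : (Fin n → ℤ) → Kˣ)
    (h : ∀ k : (Fin n → ℤ) → ℤ, ∑ a ∈ D, k a • a = 0 → ∏ a ∈ D, y a ^ k a = 1) :
    ∃ ξ : Fin n → Kˣ, ∀ a ∈ D, torusPow ξ (.ofAdd a) = y a := by
  classical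
  let ψ : ((Fin n → ℤ) → ℤ) →+ (Fin n → ℤ) :=
    { toFun := fun k => ∑ a ∈ D, k a • a
      map_zero' := by simp
      map_add' := fun k l => by simp [add_smul, Finset.sum_add_distrib] }
  let χ : ((Fin n → ℤ) → ℤ) →+ Additive Kˣ :=
    { toFun := fun k => .ofMul (∏ a ∈ D, y a ^ k a)
      map_zero' := by simp
      map_add' := fun k l => by simp [zpow_add, Finset.prod_mul_distrib] }
  -- Compatibility with relations makes `χ` a character of the image of `ψ`. Its extension `g` to
  -- `ℤⁿ` gives the point, with coordinates the values on the standard basis.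
  have hle : ψ.ker ≤ χ.ker := fun k hk => congrArg Additive.ofMul (h k hk)
  obtain ⟨g, hg⟩ := baer_units_of_isAlgClosed.extension_property_addMonoidHom
    (QuotientAddGroup.kerLift ψ) (QuotientAddGroup.kerLift_injective ψ)
    (QuotientAddGroup.lift ψ.ker χ hle)
  refine ⟨fun i => (g (Pi.single i 1)).toMul, fun a ha => ?_⟩
  have h1 : torusPow (fun i => (g (Pi.single i 1)).toMul) (.ofAdd a) = (g a).toMul := by
    conv_rhs => rw [← Finset.univ_sum_single a, map_sum, toMul_sum]
    change ∏ i, (g (Pi.single i 1)).toMul ^ a i = _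
    refine Finset.prod_congr rfl fun i _ => ?_
    have : Pi.single i (a i) = a i • (Pi.single i (1 : ℤ) : Fin n → ℤ) := by
      rw [← Pi.single_smul, smul_eq_mul, mul_one]
    rw [this, map_zsmul, toMul_zsmul]
  have h2 : ψ (Pi.single a 1) = a := by
    change ∑ b ∈ D, (Pi.single a 1 : (Fin n → ℤ) → ℤ) b • b = a
    rw [Finset.sum_eq_single_of_mem a ha fun b _ hb => by simp [Pi.single_eq_of_ne hb]]
    simp
  have h3 : χ (Pi.single a 1) = .ofMul (y a) := by
    change Additive.ofMul (∏ b ∈ D, y b ^ (Pi.single a 1 : (Fin n → ℤ) → ℤ) b) = _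
    rw [Finset.prod_eq_single_of_mem a ha fun b _ hb => by simp [Pi.single_eq_of_ne hb]]
    simp
  have h4 := DFunLike.congr_fun hg (QuotientAddGroup.mk (Pi.single a 1))
  rw [AddMonoidHom.comp_apply, QuotientAddGroup.kerLift_mk, QuotientAddGroup.lift_mk, h2, h3] at h4
  rw [h1, h4, toMul_ofMul]

theorem prod_zpow_eq_one_iff {G ι : Type*} [CommGroup G] (s : Finset ι) (y : ι → G) (k : ι → ℤ) :
    ∏ i ∈ s, y i ^ k i = 1 ↔ ∏ i ∈ s, y i ^ (k i).toNat = ∏ i ∈ s, y i ^ (-k i).toNat := by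
  have h : ∀ i ∈ s, y i ^ k i = y i ^ (k i).toNat / y i ^ (-k i).toNat := by
    intro i _
    rw [← zpow_natCast, ← zpow_natCast, div_eq_mul_inv, ← zpow_sub]
    congr 1
    omega
  rw [Finset.prod_congr rfl h, Finset.prod_div_distrib, div_eq_one]

theorem prod_zpow_eq_one_of_linearFormsBinomial_eq_zero (D : Finset (Fin n → ℤ))
    (d : (Fin n → ℤ) → K) (k : (Fin n → ℤ) → ℤ)
    (h : linearFormsBinomial D d (fun a => (k a).toNat) (fun a => (-k a).toNat) = 0) (t : K)
    (y : (Fin n → ℤ) → Kˣ) (hy : ∀ a ∈ D, (y a : K) = 1 + d a * t) :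
    ∏ a ∈ D, y a ^ k a = 1 := by
  have h1 := congrArg (Polynomial.eval t) h
  rw [linearFormsBinomial, Polynomial.eval_sub, Polynomial.eval_zero, sub_eq_zero,
    Polynomial.eval_prod, Polynomial.eval_prod] at h1
  have h2 : ∏ a ∈ D, y a ^ (k a).toNat = ∏ a ∈ D, y a ^ (-k a).toNat := by
    refine Units.ext ?_
    push_cast
    convert h1 using 1
    all_goals
      refine Finset.prod_congr rfl fun a ha => ?_
      simp [hy a ha]
  rw [prod_zpow_eq_one_iff, h2]

/-- A one-parameter family of zeros, when all integral relations between the exponent vectors are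
respected by the linear forms `1 + d_a t`. -/
theorem infinite_torusZeros [IsAlgClosed K] (A D : Finset (Fin n → ℤ)) (a₀ : Fin n → ℤ)
    (hAD : ∀ a ∈ A, a ≠ a₀ → a - a₀ ∈ D) (d : (Fin n → ℤ) → K) (hd0 : d 0 = 0)
    (b : Fin n → ℤ) (hb : b ∈ D) (hdb : d b ≠ 0)
    (hrel : ∀ p q : (Fin n → ℤ) → ℕ, ∑ a ∈ D, p a • a = ∑ a ∈ D, q a • a →
      linearFormsBinomial D d p q = 0)
    (F : Fin n → LaurentRing K n) (hF : ∀ i, (F i).coeff.support ⊆ A) (ζ : Fin n → Kˣ)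
    (h1 : ∀ i, ∑ a ∈ A, (F i).coeff a * torusPow ζ (.ofAdd a) = 0)
    (h2 : ∀ i, ∑ a ∈ A, (F i).coeff a * torusPow ζ (.ofAdd a) * d (a - a₀) = 0) :
    (torusZeros F).Infinite := by
  classical
  have hT : {t : K | ∀ a ∈ D, 1 + d a * t ≠ 0}.Infinite := by
    have : Infinite K := IsAlgClosed.instInfinite
    have hfin : (⋃ a ∈ D, {t : K | 1 + d a * t = 0}).Finite := by
      refine D.finite_toSet.biUnion fun a _ => Set.Subsingleton.finite fun t ht t' ht' => ?_
      simp only [Set.mem_ofPred_eq] at ht ht'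
      have hda : d a ≠ 0 := by
        intro h
        simp [h] at ht
      exact mul_left_cancel₀ hda (add_left_cancel (ht.trans ht'.symm))
    convert hfin.infinite_compl using 1
    ext t
    simp
  -- Moving along the line multiplies each `ζ ^ a` by `1 + d_a t`. By `hrel` these factors satisfy
  -- all relations between the exponents.
  have hpt : ∀ t ∈ {t : K | ∀ a ∈ D, 1 + d a * t ≠ 0}, ∃ ξ : Fin n → Kˣ, ∀ a ∈ D,
      (torusPow ξ (.ofAdd a) : K) = torusPow ζ (.ofAdd a) * (1 + d a * t) := by
    intro t ht
    let y : (Fin n → ℤ) → Kˣ := fun a => if h : 1 + d a * t ≠ 0 then Units.mk0 _ h else 1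
    have hy : ∀ a ∈ D, (y a : K) = 1 + d a * t := fun a ha => by
      simp only [y, dif_pos (ht a ha), Units.val_mk0]
    obtain ⟨ξ, hξ⟩ := exists_torusPow_eq D (fun a => torusPow ζ (.ofAdd a) * y a) fun k hk => by
      simp_rw [mul_zpow, Finset.prod_mul_distrib, ← map_zpow, ← ofAdd_zsmul, ← map_prod,
        ← ofAdd_sum]
      rw [hk, ofAdd_zero, map_one, one_mul]
      refine prod_zpow_eq_one_of_linearFormsBinomial_eq_zero D d k (hrel _ _ ?_) t y hy
      rw [← sub_eq_zero, ← Finset.sum_sub_distrib, ← hk]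
      refine Finset.sum_congr rfl fun a _ => ?_
      rw [← natCast_zsmul, ← natCast_zsmul, ← sub_smul]
      congr 1
      omega
    exact ⟨ξ, fun a ha => by rw [hξ a ha, Units.val_mul, hy a ha]⟩
  choose! ξ hξ using hpt
  -- The monomial of exponent `b` recovers `t`, since `d b ≠ 0`. Up to a common factor each equation
  -- becomes affine in `t`, with both coefficients zero by `h1` and `h2`.
  refine Set.infinite_of_injOn_mapsTo (f := ξ) (fun t ht t' ht' heq => ?_) (fun t ht i => ?_) hT
  · have e1 := hξ t ht b hb
    rw [heq, hξ t' ht' b hb] at e1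
    exact mul_left_cancel₀ hdb
      (add_left_cancel (mul_left_cancel₀ (torusPow ζ (.ofAdd b)).ne_zero e1.symm))
  · rw [laurentEval_eq_sum _ (hF i)]
    have key : ∀ a ∈ A, (torusPow (ξ t) (.ofAdd a) : K) =
        torusPow (ξ t) (.ofAdd a₀) * (torusPow ζ (.ofAdd a₀) : K)⁻¹ *
          (torusPow ζ (.ofAdd a) * (1 + d (a - a₀) * t)) := by
      intro a ha
      by_cases haa : a = a₀
      · subst haa
        simp [hd0]
      · have hs : ∀ η : Fin n → Kˣ, (torusPow η (.ofAdd a) : K) =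
            torusPow η (.ofAdd (a - a₀)) * torusPow η (.ofAdd a₀) := fun η => by
          rw [← Units.val_mul, ← map_mul, ← ofAdd_add, sub_add_cancel]
        rw [hs (ξ t), hs ζ, hξ t ht _ (hAD a ha haa)]
        have := (torusPow ζ (.ofAdd a₀)).ne_zero
        field_simp
    calc ∑ a ∈ A, (F i).coeff a * (torusPow (ξ t) (.ofAdd a) : K)
        = torusPow (ξ t) (.ofAdd a₀) * (torusPow ζ (.ofAdd a₀) : K)⁻¹ *
          (∑ a ∈ A, (F i).coeff a * torusPow ζ (.ofAdd a) +
            t * ∑ a ∈ A, (F i).coeff a * torusPow ζ (.ofAdd a) * d (a - a₀)) := by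
          rw [Finset.mul_sum, ← Finset.sum_add_distrib, Finset.mul_sum]
          refine Finset.sum_congr rfl fun a ha => ?_
          rw [key a ha]
          ring
      _ = 0 := by rw [h1, h2, mul_zero, add_zero, mul_zero]

end TorusPoints

/-! ### Linear systems with a solution space of dimension at most two. -/

section LinearSystems

/-- The scalar solution space `V` has dimension `card α - n ≤ 2` and contains the constants. A
linear form that vanishes on `V` is a combination of the rows, so the relations between coordinates
on `V` also hold for the `M`-valued solution `U`. -/
theorem exists_affine_parametrization {K M α : Type*} [Field K] [AddCommGroup M] [Module K M]
    [Fintype α] {n : ℕ} (hcard : Fintype.card α ≤ n + 2) (c : Fin n → α → K)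
    (hc : LinearIndependent K c) (hc1 : ∀ i, ∑ a, c i a = 0) (U : α → M)
    (hU : ∀ i, ∑ a, c i a • U a = 0) (a₀ : α) :
    ∃ (d : α → K) (b : α), d a₀ = 0 ∧ (∀ i, ∑ a, c i a * d a = 0) ∧ (d = 0 ∨ d b = 1) ∧
      (Fintype.card α = n + 1 → d = 0) ∧ ∀ a, U a - U a₀ = d a • (U b - U a₀) := by
  classical
  let V := LinearMap.ker (Matrix.mulVecLin (Matrix.of c))
  have hV : ∀ v, v ∈ V ↔ ∀ i, ∑ a, c i a * v a = 0 := fun v => by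
    rw [LinearMap.mem_ker, Matrix.mulVecLin_apply, funext_iff]
    rfl
  have hfin : Module.finrank K V + n = Fintype.card α := by
    have h1 := LinearMap.finrank_range_add_finrank_ker (Matrix.mulVecLin (Matrix.of c))
    have h2 : (Matrix.of c).rank = Fintype.card (Fin n) := LinearIndependent.rank_matrix hc
    rw [Module.finrank_pi, ← Matrix.rank, h2, Fintype.card_fin] at h1
    rw [← h1, add_comm]
  have h1V : (1 : α → K) ∈ V := (hV 1).2 fun i => by simpa using hc1 i
  -- linear forms vanishing on `V` give relations in `M`
  have transfer : ∀ ℓ : (α → K) →ₗ[K] K, (∀ v ∈ V, ℓ v = 0) → ∑ a, ℓ (Pi.single a 1) • U a = 0 := by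
    intro ℓ hℓ
    let L : Fin n → (α → K) →ₗ[K] K := fun i => ∑ a, c i a • LinearMap.proj a
    have hmem : ℓ ∈ Submodule.span K (Set.range L) := by
      refine mem_span_of_iInf_ker_le_ker fun v hv => hℓ v ((hV v).2 fun i => ?_)
      have := (Submodule.mem_iInf _).1 hv i
      simpa [L] using this
    let T : ((α → K) →ₗ[K] K) →ₗ[K] M :=
      ∑ a, (LinearMap.toSpanSingleton K M (U a)).comp (LinearMap.applyₗ (Pi.single a 1))
    have hle : Submodule.span K (Set.range L) ≤ LinearMap.ker T := by
      rw [Submodule.span_le]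
      rintro _ ⟨i, rfl⟩
      simpa [T, L, Pi.single_apply] using hU i
    simpa [T] using hle hmem
  by_cases hconst : ∀ v ∈ V, ∀ a, v a = v a₀
  · refine ⟨0, a₀, rfl, by simp, Or.inl rfl, fun _ => rfl, fun a => ?_⟩
    have := transfer ((LinearMap.proj a : (α → K) →ₗ[K] K) - LinearMap.proj a₀) fun v hv => by
      simp [hconst v hv a]
    simpa [Pi.single_apply, sub_smul, Finset.sum_sub_distrib] using this
  · push Not at hconst
    obtain ⟨v, hv, b, hvb⟩ := hconst
    have hvb' : v b - v a₀ ≠ 0 := sub_ne_zero.2 hvb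
    -- A nonconstant solution, normalized to be `0` at `a₀` and `1` at `b`. With the constants it
    -- spans `V`, so the coordinates at `a₀` and `b` determine a solution.
    let d : α → K := (v b - v a₀)⁻¹ • (v - v a₀ • 1)
    have hdV : d ∈ V := V.smul_mem _ (V.sub_mem hv (V.smul_mem _ h1V))
    have hd0 : d a₀ = 0 := by simp [d]
    have hdb : d b = 1 := by simp [d, hvb']
    let e : V →ₗ[K] K × K := ((LinearMap.proj a₀).prod (LinearMap.proj b)).comp V.subtype
    have hsurj : Function.Surjective e := by
      rintro ⟨x, y⟩
      refine ⟨⟨x • 1 + (y - x) • d, V.add_mem (V.smul_mem _ h1V) (V.smul_mem _ hdV)⟩, ?_⟩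
      simp [e, hd0, hdb]
    have hge := LinearMap.finrank_le_finrank_of_surjective hsurj
    have h2 : Module.finrank K (K × K) = 2 := by simp
    have hinj : Function.Injective e :=
      (LinearMap.injective_iff_surjective_of_finrank_eq_finrank (by omega)).2 hsurj
    refine ⟨d, b, hd0, (hV d).1 hdV, Or.inr hdb, fun h => by omega, fun a => ?_⟩
    have := transfer ((LinearMap.proj a : (α → K) →ₗ[K] K) - LinearMap.proj a₀ -
      d a • ((LinearMap.proj b : (α → K) →ₗ[K] K) - LinearMap.proj a₀)) fun x hx => by
        have hz : (⟨x - (x a₀ • 1 + (x b - x a₀) • d), V.sub_mem hx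
          (V.add_mem (V.smul_mem _ h1V) (V.smul_mem _ hdV))⟩ : V) = 0 := by
          refine hinj ?_
          rw [map_zero]
          simp [e, hd0, hdb]
        have := congrFun (congrArg Subtype.val hz) a
        simp only [Pi.sub_apply, Pi.add_apply, Pi.smul_apply, Pi.one_apply, smul_eq_mul, mul_one,
          ZeroMemClass.coe_zero, Pi.zero_apply] at this
        simp only [LinearMap.sub_apply, LinearMap.smul_apply, LinearMap.proj_apply, smul_eq_mul]
        linear_combination this
    rw [← sub_eq_zero]
    simpa [Pi.single_apply, sub_smul, Finset.sum_sub_distrib, mul_sub, mul_smul, smul_sub] using this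

end LinearSystems

/-! ### The local quotient at a zero and its universal property. -/

section LocalQuotient

open IsLocalRing

variable {K : Type*} [Field K] {n : ℕ}

/-- The canonical homomorphism from the Laurent polynomial ring to the local quotient at `ζ`. -/
noncomputable def toLocalQuotient (F : Fin n → LaurentRing K n) (ζ : Fin n → Kˣ) :
    LaurentRing K n →ₐ[K] TorusLocalRing ζ ⧸ localIdeal F ζ :=
  (Ideal.Quotient.mkₐ K (localIdeal F ζ)).comp
    (IsScalarTower.toAlgHom K (LaurentRing K n) (TorusLocalRing ζ))

theorem toLocalQuotient_apply (F : Fin n → LaurentRing K n) (ζ : Fin n → Kˣ)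
    (f : LaurentRing K n) : toLocalQuotient F ζ f =
      Ideal.Quotient.mk (localIdeal F ζ) (algebraMap (LaurentRing K n) (TorusLocalRing ζ) f) := rfl

theorem toLocalQuotient_system (F : Fin n → LaurentRing K n) (ζ : Fin n → Kˣ) (i : Fin n) :
    toLocalQuotient F ζ (F i) = 0 := by
  rw [toLocalQuotient_apply, Ideal.Quotient.eq_zero_iff_mem]
  exact Ideal.subset_span ⟨i, rfl⟩

theorem exists_toLocalQuotient_mul_eq (F : Fin n → LaurentRing K n) (ζ : Fin n → Kˣ)
    (x : TorusLocalRing ζ ⧸ localIdeal F ζ) :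
    ∃ f g : LaurentRing K n, laurentEval ζ g ≠ 0 ∧ IsUnit (toLocalQuotient F ζ g) ∧
      x * toLocalQuotient F ζ g = toLocalQuotient F ζ f := by
  obtain ⟨y, rfl⟩ := Ideal.Quotient.mk_surjective x
  obtain ⟨⟨f, g⟩, h⟩ := IsLocalization.surj (RingHom.ker (laurentEval ζ)).primeCompl y
  refine ⟨f, g, g.2, (IsLocalization.map_units (TorusLocalRing ζ) g).map (Ideal.Quotient.mk _), ?_⟩
  rw [toLocalQuotient_apply, toLocalQuotient_apply, ← map_mul, h]

theorem exists_localQuotient_lift (F : Fin n → LaurentRing K n) (ζ : Fin n → Kˣ)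
    {B : Type*} [CommRing B] [Algebra K B] (ψ : LaurentRing K n →ₐ[K] B)
    (hunit : ∀ f, laurentEval ζ f ≠ 0 → IsUnit (ψ f)) (hF : ∀ i, ψ (F i) = 0) :
    ∃ Ψ : (TorusLocalRing ζ ⧸ localIdeal F ζ) →ₐ[K] B, ∀ f, Ψ (toLocalQuotient F ζ f) = ψ f := by
  let Φ : TorusLocalRing ζ →ₐ[K] B :=
    IsLocalization.liftAlgHom (M := (RingHom.ker (laurentEval ζ)).primeCompl) (f := ψ)
      fun y => hunit y y.2
  have hΦ : ∀ f, Φ (algebraMap (LaurentRing K n) (TorusLocalRing ζ) f) = ψ f := fun f =>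
    IsLocalization.lift_eq _ f
  have hker : ∀ x ∈ localIdeal F ζ, Φ x = 0 := by
    have : localIdeal F ζ ≤ RingHom.ker Φ := by
      rw [localIdeal, Ideal.span_le]
      rintro _ ⟨i, rfl⟩
      exact (hΦ _).trans (hF i)
    exact fun x hx => this hx
  exact ⟨Ideal.Quotient.liftₐ _ Φ hker, fun f => hΦ f⟩

theorem exists_localQuotient_eval (F : Fin n → LaurentRing K n) (ζ : Fin n → Kˣ)
    (hζ : ζ ∈ torusZeros F) : ∃ Ψ : (TorusLocalRing ζ ⧸ localIdeal F ζ) →ₐ[K] K,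
      ∀ f, Ψ (toLocalQuotient F ζ f) = laurentEval ζ f :=
  exists_localQuotient_lift F ζ (laurentEval ζ) (fun _ h => IsUnit.mk0 _ h) hζ

theorem nontrivial_localQuotient (F : Fin n → LaurentRing K n) (ζ : Fin n → Kˣ)
    (hζ : ζ ∈ torusZeros F) : Nontrivial (TorusLocalRing ζ ⧸ localIdeal F ζ) :=
  (exists_localQuotient_eval F ζ hζ).choose.toRingHom.domain_nontrivial

theorem isLocalRing_localQuotient (F : Fin n → LaurentRing K n) (ζ : Fin n → Kˣ)
    (hζ : ζ ∈ torusZeros F) : IsLocalRing (TorusLocalRing ζ ⧸ localIdeal F ζ) :=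
  have := nontrivial_localQuotient F ζ hζ
  IsLocalRing.of_surjective' (Ideal.Quotient.mk (localIdeal F ζ)) Ideal.Quotient.mk_surjective

theorem isNoetherianRing_localQuotient (F : Fin n → LaurentRing K n) (ζ : Fin n → Kˣ) :
    IsNoetherianRing (TorusLocalRing ζ ⧸ localIdeal F ζ) :=
  have : IsNoetherianRing (TorusLocalRing ζ) :=
    IsLocalization.isNoetherianRing (RingHom.ker (laurentEval ζ)).primeCompl _ inferInstance
  inferInstance

end LocalQuotient

/-! ### Monomials normalized to have value `1` at the point. -/

section NormalizedCharacter

open IsLocalRing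

variable {K Q : Type*} [Field K] [CommRing Q] [Algebra K Q] {n : ℕ}

/-- The character `a ↦ x ^ a / ζ ^ a` with values in an algebra over the Laurent polynomial ring. -/
noncomputable def normalizedCharacter (Λ : LaurentRing K n →ₐ[K] Q) (ζ : Fin n → Kˣ) :
    Multiplicative (Fin n → ℤ) →* Q where
  toFun a := Λ (AddMonoidAlgebra.single a.toAdd ((torusPow ζ a)⁻¹ : Kˣ))
  map_one' := by
    rw [toAdd_one, map_one, inv_one, Units.val_one, ← AddMonoidAlgebra.one_def, map_one]
  map_mul' a b := by
    rw [← map_mul, AddMonoidAlgebra.single_mul_single, ← Units.val_mul, ← mul_inv, ← map_mul]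
    rfl

theorem laurentAlgHom_single_eq_smul (Λ : LaurentRing K n →ₐ[K] Q) (ζ : Fin n → Kˣ)
    (a : Fin n → ℤ) (c : K) : Λ (AddMonoidAlgebra.single a c) =
      (c * torusPow ζ (.ofAdd a)) • normalizedCharacter Λ ζ (.ofAdd a) := by
  change _ = _ • Λ (AddMonoidAlgebra.single a ((torusPow ζ (.ofAdd a))⁻¹ : Kˣ))
  rw [← map_smul, AddMonoidAlgebra.smul_single]
  simp

theorem laurentAlgHom_eq_sum (Λ : LaurentRing K n →ₐ[K] Q) (ζ : Fin n → Kˣ)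
    {f : LaurentRing K n} {A : Finset (Fin n → ℤ)} (hf : f.coeff.support ⊆ A) :
    Λ f = ∑ a ∈ A,
      (f.coeff a * torusPow ζ (.ofAdd a)) • normalizedCharacter Λ ζ (.ofAdd a) := by
  conv_lhs => rw [laurentRing_eq_sum hf, map_sum]
  simp only [laurentAlgHom_single_eq_smul Λ ζ]

variable [IsLocalRing Q] (Λ : LaurentRing K n →ₐ[K] Q) (Ψ : Q →ₐ[K] K)

theorem ker_eq_maximalIdeal : RingHom.ker Ψ = maximalIdeal Q :=
  IsLocalRing.eq_maximalIdeal (RingHom.ker_isMaximal_of_surjective _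
    fun c => ⟨algebraMap K _ c, Ψ.commutes c⟩)

theorem maximalIdeal_eq_span_normalizedCharacter (ζ : Fin n → Kˣ)
    (hΨ : ∀ f, Ψ (Λ f) = laurentEval ζ f)
    (hfrac : ∀ x, ∃ f g, IsUnit (Λ g) ∧ x * Λ g = Λ f) :
    maximalIdeal Q = Ideal.span (Set.range fun a => normalizedCharacter Λ ζ a - 1) := by
  refine le_antisymm (fun x hx => ?_) ?_
  · obtain ⟨f, g, hg, hfg⟩ := hfrac x
    rw [← ker_eq_maximalIdeal Ψ, RingHom.mem_ker] at hx
    have hf : laurentEval ζ f = 0 := by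
      rw [← hΨ, ← hfg, map_mul, hx, zero_mul]
    rw [← Ideal.mul_unit_mem_iff_mem _ hg, hfg]
    -- The weights sum to the value of `f` at `ζ`, which is zero, so `1` may be subtracted from each
    -- character value.
    have h1 : Λ f = ∑ a ∈ f.coeff.support,
        (f.coeff a * torusPow ζ (.ofAdd a)) • (normalizedCharacter Λ ζ (.ofAdd a) - 1) := by
      simp_rw [smul_sub, Finset.sum_sub_distrib, ← Finset.sum_smul]
      rw [← laurentEval_eq_sum ζ subset_rfl, hf, zero_smul, sub_zero,
        laurentAlgHom_eq_sum Λ ζ subset_rfl]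
    rw [h1]
    exact Ideal.sum_mem _ fun a _ => by
      rw [Algebra.smul_def]
      exact Ideal.mul_mem_left _ _ (Ideal.subset_span ⟨_, rfl⟩)
  · rw [Ideal.span_le]
    rintro _ ⟨a, rfl⟩
    rw [← ker_eq_maximalIdeal Ψ, SetLike.mem_coe, RingHom.mem_ker, map_sub, map_one, sub_eq_zero]
    change Ψ (Λ _) = 1
    rw [hΨ]
    exact (laurentEval_single_eq_torusPow ζ _ _).trans (Units.inv_mul _)

end NormalizedCharacter

/-! ### The upper bound for the dimension of the local quotient. -/

section Bounds

open IsLocalRing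

variable {K Q : Type*} [Field K] [CommRing Q] [Algebra K Q] {n : ℕ}

/-- A nonzero such form would be constant on `A` and put `n + 1` of its points into a hyperplane. -/
theorem linearForm_eq_zero_of_noPointsInHyperplane {A : Finset (Fin n → ℤ)}
    (hA : NoPointsInHyperplane A) (hcard : n + 1 ≤ A.card) (a₀ : Fin n → ℤ)
    (f : (Fin n → ℚ) →ₗ[ℚ] ℚ) (hf : ∀ a ∈ A, a ≠ a₀ → f (fun i => ((a - a₀) i : ℚ)) = 0) : f = 0 := by
  by_contra hne
  obtain ⟨S, hSA, hS⟩ := Finset.exists_subset_card_eq hcard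
  refine hA S hSA hS ⟨fun i => (f (Pi.single i 1) : ℝ), (f (fun i => (a₀ i : ℚ)) : ℝ),
    fun h0 => hne ?_, fun a ha => ?_⟩
  · refine LinearMap.pi_ext' fun i => LinearMap.ext_ring ?_
    have := congrFun h0 i
    simpa using this
  · have h1 : f (fun i => (a i : ℚ)) = f (fun i => (a₀ i : ℚ)) := by
      by_cases h : a = a₀
      · rw [h]
      · rw [← sub_eq_zero, ← map_sub, ← hf a (hSA ha) h]
        congr 1
        ext i
        simp
    rw [← h1, LinearMap.pi_apply_eq_sum_univ f]
    push_cast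
    refine Finset.sum_congr rfl fun i _ => ?_
    have h2 : (fun j => if i = j then (1 : ℚ) else 0) = Pi.single i 1 := by
      ext j
      simp [Pi.single_apply, eq_comm]
    rw [h2]
    simp [mul_comm]

theorem linearIndependent_scaled_coeff {A : Finset (Fin n → ℤ)} {F : Fin n → LaurentRing K n}
    (hF : ∀ i, (F i).coeff.support ⊆ A) (hind : LinearIndependent K F) (ζ : Fin n → Kˣ) :
    LinearIndependent K fun i (a : A) => (F i).coeff a * (torusPow ζ (.ofAdd a.1) : K) := by
  rw [Fintype.linearIndependent_iff] at hind ⊢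
  intro g hg
  refine hind g (AddMonoidAlgebra.coeff_injective (Finsupp.ext fun a => ?_))
  simp only [AddMonoidAlgebra.coeff_sum, AddMonoidAlgebra.coeff_smul, Finsupp.coe_finsetSum,
    Finset.sum_apply, Finsupp.smul_apply, AddMonoidAlgebra.coeff_zero, Finsupp.coe_zero,
    Pi.zero_apply]
  by_cases ha : a ∈ A
  · have := congrFun hg ⟨a, ha⟩
    simp only [Finset.sum_apply, Pi.smul_apply, Pi.zero_apply, smul_eq_mul, ← mul_assoc,
      ← Finset.sum_mul] at this
    exact (mul_eq_zero.1 this).resolve_right (torusPow ζ (.ofAdd a)).ne_zero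
  · refine Finset.sum_eq_zero fun i _ => ?_
    rw [Finsupp.notMem_support_iff.1 fun h => ha (hF i h), smul_zero]

/-- The bound for the length of the local quotient, for an abstract model `Q` of it. -/
theorem exists_rank_le [IsAlgClosed K] [CharZero K] [IsLocalRing Q] [IsNoetherianRing Q]
    (A : Finset (Fin n → ℤ)) (F : Fin n → LaurentRing K n)
    (hlower : n + 1 ≤ A.card) (hupper : A.card ≤ n + 2) (hA : NoPointsInHyperplane A)
    (hF : ∀ i, (F i).coeff.support ⊆ A) (hfin : (torusZeros F).Finite) (ζ : Fin n → Kˣ)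
    (hζ : ζ ∈ torusZeros F) (Λ : LaurentRing K n →ₐ[K] Q) (Ψ : Q →ₐ[K] K)
    (hΨ : ∀ f, Ψ (Λ f) = laurentEval ζ f)
    (hfrac : ∀ x, ∃ f g, IsUnit (Λ g) ∧ x * Λ g = Λ f) (hΛ : ∀ i, Λ (F i) = 0) :
    ∃ k : ℕ, Module.rank K Q ≤ k ∧ k ≤ n + 1 ∧ (A.card = n + 1 → k = 1) := by
  classical
  have hm := maximalIdeal_eq_span_normalizedCharacter Λ Ψ ζ hΨ hfrac
  have hK : ∀ q : Q, ∃ c : K, q - algebraMap K Q c ∈ maximalIdeal Q := fun q => ⟨Ψ q, by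
    rw [← ker_eq_maximalIdeal Ψ, RingHom.mem_ker, map_sub, Ψ.commutes]
    exact sub_self _⟩
  set u := normalizedCharacter Λ ζ with hu
  obtain ⟨a₀, ha₀⟩ : A.Nonempty := Finset.card_pos.1 (by omega)
  have hind := linearIndependent_of_finite_torusZeros F hfin ζ hζ
  obtain ⟨d, b, hd0, hcd, hdb, hd, hud⟩ := exists_affine_parametrization (by simpa using hupper)
    _ (linearIndependent_scaled_coeff hF hind ζ)
    (fun i => by
      rw [Finset.sum_coe_sort A fun a => (F i).coeff a * (torusPow ζ (.ofAdd a) : K),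
        ← laurentEval_eq_sum ζ (hF i)]
      exact hζ i)
    (fun a : A => u (.ofAdd a.1))
    (fun i => by
      rw [Finset.sum_coe_sort A fun a =>
        ((F i).coeff a * (torusPow ζ (.ofAdd a) : K)) • u (.ofAdd a),
        ← laurentAlgHom_eq_sum Λ ζ (hF i)]
      exact hΛ i) ⟨a₀, ha₀⟩
  rw [Fintype.card_coe] at hd
  -- The slopes are reindexed by differences `a - a₀`; the value at `0` is `d a₀ = 0`.
  let d' : (Fin n → ℤ) → K := fun v => if h : v + a₀ ∈ A then d ⟨v + a₀, h⟩ else 0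
  have hd' : ∀ a (ha : a ∈ A), d' (a - a₀) = d ⟨a, ha⟩ := fun a ha => by
    simp only [d', sub_add_cancel, dif_pos ha]
  let D : Finset (Fin n → ℤ) := (A.erase a₀).image (· - a₀)
  have hDcard : D.card ≤ n + 1 := by
    refine Finset.card_image_le.trans ?_
    rw [Finset.card_erase_of_mem ha₀]
    omega
  have hspan : ∀ f : (Fin n → ℚ) →ₗ[ℚ] ℚ,
      (∀ a ∈ (D : Set (Fin n → ℤ)), f (fun i => (a i : ℚ)) = 0) → f = 0 := fun f hf =>
    linearForm_eq_zero_of_noPointsInHyperplane hA hlower a₀ f fun a ha hne =>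
      hf _ (Finset.mem_image_of_mem _ (Finset.mem_erase.2 ⟨hne, ha⟩))
  let w : Q := u (.ofAdd (b.1 - a₀)) - 1
  have hw : w ∈ maximalIdeal Q := hm ▸ Ideal.subset_span ⟨_, rfl⟩
  have huw : ∀ a (ha : a ∈ A), u (.ofAdd (a - a₀)) = 1 + algebraMap K Q (d ⟨a, ha⟩) * w := by
    intro a ha
    -- Multiplication by `u (-a₀)` turns the affine relation into one normalized at `1`.
    have h1 := congrArg (· * u (.ofAdd (-a₀))) (hud ⟨a, ha⟩)
    simp only [Algebra.smul_def, mul_assoc, sub_mul, ← map_mul, ← ofAdd_add, add_neg_cancel,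
      ofAdd_zero, map_one, ← sub_eq_add_neg] at h1
    rw [← h1]
    ring
  have huD : ∀ a ∈ (D : Set (Fin n → ℤ)),
      u (.ofAdd a) = 1 + algebraMap K Q (d' a) * w := by
    intro a ha
    obtain ⟨a, ha', rfl⟩ := Finset.mem_image.1 ha
    rw [hd' a (Finset.mem_of_mem_erase ha'), huw]
  have hrank := rank_le_of_characters hK u hm D hspan d' w hw huD
  by_cases hd00 : d = 0
  · refine ⟨1, hrank 1 ?_, by omega, fun _ => rfl⟩
    have := huw b b.2
    rw [hd00, Pi.zero_apply, map_zero, zero_mul, add_zero] at this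
    simp only [w, this, sub_self, pow_one]
  · have hdb1 := hdb.resolve_left hd00
    -- If every relation is trivial along the line, the zero set is infinite. Otherwise one relation
    -- gives a nonzero polynomial that annihilates `w`.
    by_cases hrel : ∀ p q : (Fin n → ℤ) → ℕ, ∑ a ∈ D, p a • a = ∑ a ∈ D, q a • a →
      linearFormsBinomial D d' p q = 0
    · have hba : b.1 ≠ a₀ := by
        intro h
        have : b = ⟨a₀, ha₀⟩ := Subtype.ext h
        rw [this, hd0] at hdb1
        exact zero_ne_one hdb1
      refine absurd hfin (infinite_torusZeros A D a₀ (fun a ha hne =>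
        Finset.mem_image_of_mem _ (Finset.mem_erase.2 ⟨hne, ha⟩)) d' ?_ (b.1 - a₀)
        (Finset.mem_image_of_mem _ (Finset.mem_erase.2 ⟨hba, b.2⟩)) ?_ hrel F hF ζ
        (fun i => ?_) (fun i => ?_))
      · simpa [hd0] using hd' a₀ ha₀
      · rw [hd' _ b.2, hdb1]
        exact one_ne_zero
      · rw [← laurentEval_eq_sum ζ (hF i)]
        exact hζ i
      · rw [← hcd i, ← Finset.sum_coe_sort A]
        exact Finset.sum_congr rfl fun a _ => by rw [hd' _ a.2]
    · push Not at hrel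
      obtain ⟨p, q, hpq, hne⟩ := hrel
      obtain ⟨k, hk, g, hg, heq⟩ := exists_linearFormsBinomial_eq D d' p q hne
      refine ⟨k, hrank k (pow_eq_zero_of_aeval_eq_zero hw hg ?_), hk.trans hDcard,
        fun h => absurd (hd h) hd00⟩
      rw [← heq]
      exact aeval_linearFormsBinomial_eq_zero u D d' w huD p q hpq

end Bounds

/-! ### From ranks to intersection multiplicities. -/

section IntersectionMultiplicity
variable {K : Type*} [Field K] {n : ℕ}

/-- Passes to the module structure that comes from the `K`-algebra, which the rank estimates use;
the two agree definitionally. -/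
theorem intersectionMultiplicity_eq_rank (F : Fin n → LaurentRing K n) (ζ : Fin n → Kˣ) :
    intersectionMultiplicity F ζ = Cardinal.toENat (@Module.rank K (TorusLocalRing ζ ⧸ localIdeal F ζ)
      _ _ Algebra.toModule) := rfl

theorem le_intersectionMultiplicity_of_surjective {B : Type*} [CommRing B] [Algebra K B]
    [Module.Finite K B] (F : Fin n → LaurentRing K n) (ζ : Fin n → Kˣ)
    (Ψ : (TorusLocalRing ζ ⧸ localIdeal F ζ) →ₐ[K] B) (hΨ : Function.Surjective Ψ) :
    (Module.finrank K B : ℕ∞) ≤ intersectionMultiplicity F ζ := by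
  rw [intersectionMultiplicity_eq_rank, Cardinal.natCast_le_toENat]
  have h := LinearMap.lift_rank_le_of_surjective Ψ.toLinearMap hΨ
  rwa [← Module.finrank_eq_rank, Cardinal.lift_natCast, Cardinal.nat_le_lift_iff] at h

theorem one_le_intersectionMultiplicity (F : Fin n → LaurentRing K n) (ζ : Fin n → Kˣ)
    (hζ : ζ ∈ torusZeros F) : 1 ≤ intersectionMultiplicity F ζ := by
  obtain ⟨Ψ, -⟩ := exists_localQuotient_eval F ζ hζ
  have := le_intersectionMultiplicity_of_surjective F ζ Ψ
    fun c => ⟨algebraMap K _ c, Ψ.commutes c⟩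
  rwa [Module.finrank_self, Nat.cast_one] at this

theorem localQuotient_rank [IsAlgClosed K] [CharZero K]
    (A : Finset (Fin n → ℤ)) (F : Fin n → LaurentRing K n)
    (hlower : n + 1 ≤ A.card) (hupper : A.card ≤ n + 2) (hA : NoPointsInHyperplane A)
    (hF : ∀ i, (F i).coeff.support ⊆ A) (hfin : (torusZeros F).Finite) (ζ : Fin n → Kˣ)
    (hζ : ζ ∈ torusZeros F) :
    ∃ k : ℕ, @Module.rank K (TorusLocalRing ζ ⧸ localIdeal F ζ) _ _ Algebra.toModule ≤ k ∧
      k ≤ n + 1 ∧ (A.card = n + 1 → k = 1) := 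
  have := isLocalRing_localQuotient F ζ hζ
  have := isNoetherianRing_localQuotient F ζ
  have ⟨Ψ, hΨ⟩ := exists_localQuotient_eval F ζ hζ
  have hfrac : ∀ x, ∃ f g, IsUnit (toLocalQuotient F ζ g) ∧
      x * toLocalQuotient F ζ g = toLocalQuotient F ζ f := fun x =>
    have ⟨f, g, _, h⟩ := exists_toLocalQuotient_mul_eq F ζ x
    ⟨f, g, h⟩
  exists_rank_le (Q := TorusLocalRing ζ ⧸ localIdeal F ζ) A F hlower hupper hA hF hfin ζ hζ
    (toLocalQuotient F ζ) Ψ hΨ hfrac (toLocalQuotient_system F ζ)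

theorem intersectionMultiplicity_bounds [IsAlgClosed K] [CharZero K]
    (A : Finset (Fin n → ℤ)) (F : Fin n → LaurentRing K n)
    (hlower : n + 1 ≤ A.card) (hupper : A.card ≤ n + 2) (hA : NoPointsInHyperplane A)
    (hF : ∀ i, (F i).coeff.support ⊆ A) (hfin : (torusZeros F).Finite) (ζ : Fin n → Kˣ)
    (hζ : ζ ∈ torusZeros F) :
    intersectionMultiplicity F ζ ≤ n + 1 ∧
      (A.card = n + 1 → intersectionMultiplicity F ζ = 1) := by
  obtain ⟨k, hk, hkn, hk1⟩ := localQuotient_rank A F hlower hupper hA hF hfin ζ hζ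
  have hle : intersectionMultiplicity F ζ ≤ k :=
    (intersectionMultiplicity_eq_rank F ζ).trans_le (Cardinal.toENat_le_natCast.2 hk)
  refine ⟨hle.trans (by exact_mod_cast hkn), fun h => le_antisymm ?_ ?_⟩
  · rw [hk1 h] at hle
    exact_mod_cast hle
  · exact one_le_intersectionMultiplicity F ζ hζ

end IntersectionMultiplicity

/-! ### A binomial that vanishes to order at least `n + 1`. -/

section AlternatingBinomials

open Polynomial

/-- Divided by `∏ (1 + d_j X)`, the difference is `∑ (p_j - q_j) d_j / (1 + d_j X)`. In the
geometric expansion the coefficient of `X ^ i` is, up to sign, the power sum of degree `i + 1`. -/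
theorem X_pow_dvd_logDerivNumerator_sub {K ι : Type*} [Field K] [DecidableEq ι] (s : Finset ι)
    (d : ι → K) (p q : ι → ℕ) (k : ℕ)
    (h : ∀ i < k, ∑ j ∈ s, ((p j : K) - q j) * d j ^ (i + 1) = 0) :
    X ^ k ∣ logDerivNumerator s d p - logDerivNumerator s d q := by
  have h1 : logDerivNumerator s d p - logDerivNumerator s d q =
      (∏ i ∈ s, (1 + C (d i) * X)) *
        (∑ j ∈ s, ∑ i ∈ Finset.range k, C (((p j : K) - q j) * d j ^ (i + 1)) * (-X) ^ i) +
      X ^ k * ∑ j ∈ s, C ((p j : K) - q j) * C (d j) * C (-d j) ^ k *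
        ∏ i ∈ s.erase j, (1 + C (d i) * X) := by
    rw [logDerivNumerator, logDerivNumerator, ← Finset.sum_sub_distrib, Finset.mul_sum,
      Finset.mul_sum, ← Finset.sum_add_distrib]
    refine Finset.sum_congr rfl fun j hj => ?_
    rw [← Finset.mul_prod_erase s (fun i => 1 + C (d i) * X) hj]
    have h2 := mul_neg_geom_sum (-(C (d j) * X)) k
    have h3 : ∑ i ∈ Finset.range k, C (((p j : K) - q j) * d j ^ (i + 1)) * (-X) ^ i =
        C ((p j : K) - q j) * C (d j) * ∑ i ∈ Finset.range k, (-(C (d j) * X)) ^ i := by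
      rw [Finset.mul_sum]
      refine Finset.sum_congr rfl fun i _ => ?_
      rw [C_mul, C_pow, neg_mul_eq_mul_neg, mul_pow]
      ring
    rw [h3]
    have h4 : X ^ k * C (-d j) ^ k = (-(C (d j) * X)) ^ k := by
      rw [← mul_pow, C_neg]
      ring
    simp only [C_sub, map_natCast]
    linear_combination (-(((p j : K[X]) - q j) * C (d j) * ∏ i ∈ s.erase j, (1 + C (d i) * X))) *
      (h2 + h4)
  rw [h1, Finset.sum_comm]
  simp_rw [← Finset.sum_mul, ← map_sum]
  rw [Finset.sum_eq_zero fun i hi => by rw [h i (Finset.mem_range.1 hi)]; simp]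
  simp

/-- The alternating binomial coefficients `(-1) ^ k * choose (n + 1) k`. -/
def altChoose (n k : ℕ) : ℤ := (-1) ^ k * ((n + 1).choose k : ℤ)

theorem altChoose_last (n : ℕ) : altChoose n (n + 1) = (-1) ^ (n + 1) := by simp [altChoose]

theorem altChoose_ne_zero {n k : ℕ} (hk : k < n + 2) : altChoose n k ≠ 0 :=
  mul_ne_zero (pow_ne_zero _ (by norm_num))
    (by exact_mod_cast (Nat.choose_pos (by omega : k ≤ n + 1)).ne')

theorem two_le_choose {n i : ℕ} (hi : i < n) : 2 ≤ (n + 1).choose (i + 1) := by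
  rw [Nat.choose_succ_succ]
  have h1 := Nat.choose_pos hi.le
  have h2 := Nat.choose_pos (Nat.succ_le_of_lt hi)
  omega

/-- Up to sign this is an `(n + 1)`-st finite difference of a polynomial of degree at most `n`. -/
theorem sum_altChoose_mul_pow (n i : ℕ) (hi : i ≤ n) :
    ∑ k ∈ Finset.range (n + 2), altChoose n k * (k : ℤ) ^ i = 0 := by
  have h := congrFun (fwdDiff_iter_pow_eq_zero_of_lt (R := ℤ) (Nat.lt_succ_of_le hi)) 0
  rw [fwdDiff_iter_eq_sum_shift] at h
  simp only [zero_add, Pi.zero_apply, smul_eq_mul, nsmul_eq_mul, mul_one] at h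
  have h2 : ∑ k ∈ Finset.range (n + 2), altChoose n k * (k : ℤ) ^ i =
      (-1) ^ (n + 1) * ∑ k ∈ Finset.range (n + 2),
        (-1) ^ (n + 1 - k) * ((n + 1).choose k : ℤ) * (k : ℤ) ^ i := by
    rw [Finset.mul_sum]
    refine Finset.sum_congr rfl fun k hk => ?_
    have hk' : k ≤ n + 1 := by
      have := Finset.mem_range.1 hk
      omega
    have h3 : ((-1 : ℤ)) ^ (n + 1) * (-1) ^ (n + 1 - k) = (-1) ^ k := by
      rw [← pow_add, show n + 1 + (n + 1 - k) = k + 2 * (n + 1 - k) by omega, pow_add, pow_mul]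
      simp
    rw [altChoose, ← h3]
    ring
  rw [h2]
  simp only [Nat.succ_eq_add_one, add_assoc, Nat.reduceAdd] at h
  rw [h, mul_zero]

/-- The polynomial `∏ (1 + k X) ^ μₖ⁺ - ∏ (1 + k X) ^ μₖ⁻` for the alternating binomial
coefficients `μₖ`. -/
noncomputable def altPoly (K : Type*) [Field K] (n : ℕ) : K[X] :=
  linearFormsBinomial (Finset.range (n + 2)) (fun k => (k : K)) (fun k => (altChoose n k).toNat)
    (fun k => (-altChoose n k).toNat)

theorem X_pow_dvd_altPoly (K : Type*) [Field K] [CharZero K] (n : ℕ) :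
    X ^ (n + 1) ∣ altPoly K n := by
  rw [altPoly, X_pow_dvd_linearFormsBinomial_iff]
  refine X_pow_dvd_logDerivNumerator_sub _ _ _ _ _ fun i hi => ?_
  have h := congrArg (Int.cast : ℤ → K) (sum_altChoose_mul_pow n (i + 1) hi)
  push_cast at h
  rw [← h]
  refine Finset.sum_congr rfl fun k _ => ?_
  congr 1
  rw [← Int.cast_natCast, ← Int.cast_natCast (R := K) (-altChoose n k).toNat, ← Int.cast_sub]
  congr 1
  omega

theorem altPoly_ne_zero (K : Type*) [Field K] [CharZero K] (n : ℕ) : altPoly K n ≠ 0 := by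
  intro h
  -- At `-1` only the factor with `k = 1` vanishes. Since `altChoose n 1` is negative, it occurs in
  -- the second product only.
  have h1 := congrArg (eval (-1)) h
  have hm : altChoose n 1 = -(n + 1) := by simp [altChoose]
  rw [altPoly, linearFormsBinomial, eval_sub, eval_zero, eval_prod, eval_prod,
    Finset.prod_eq_zero (i := 1) (s := Finset.range (n + 2))
      (f := fun k : ℕ => eval (-1) ((1 + C (k : K) * X) ^ (-altChoose n k).toNat))
      (by simp) (by
        rw [hm]
        simp), sub_zero, Finset.prod_eq_zero_iff] at h1
  obtain ⟨k, -, hk⟩ := h1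
  rw [eval_pow] at hk
  by_cases hk1 : k = 1
  · subst hk1
    have : (-((n : ℤ) + 1)).toNat = 0 := by omega
    rw [hm, this, pow_zero] at hk
    exact one_ne_zero hk
  · have h3 := eq_zero_of_pow_eq_zero hk
    simp only [eval_add, eval_one, eval_mul, eval_C, eval_X, mul_neg, mul_one] at h3
    rw [← sub_eq_add_neg, sub_eq_zero] at h3
    exact hk1 (by exact_mod_cast h3.symm)

end AlternatingBinomials

/-! ### The extremal support and system. -/

section SharpSystem

open Polynomial

variable {K : Type*} [Field K] {n : ℕ}

/-- The points `0, e₁, …, eₙ` and a further point, satisfying the affine relation whose coefficients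
are the alternating binomial coefficients. -/
def altPoint (n k : ℕ) : Fin n → ℤ := fun i =>
  if k = n + 1 then (-1) ^ n * altChoose n (i + 1) else if k = i + 1 then 1 else 0

theorem altPoint_zero : altPoint n 0 = 0 := by
  ext i
  simp [altPoint]

theorem altPoint_succ (i : Fin n) : altPoint n (i + 1) = Pi.single i 1 := by
  ext j
  have := i.2
  rw [altPoint, if_neg (by omega), Pi.single_apply]
  simp [Fin.ext_iff, eq_comm]

/-- The last coefficient is the sign `(-1) ^ (n + 1)`, so the relation can be solved integrally for
the last point; this dictates its definition. -/
theorem sum_altChoose_smul_altPoint :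
    ∑ k ∈ Finset.range (n + 2), altChoose n k • altPoint n k = 0 := by
  ext i
  have hi := i.2
  rw [Finset.sum_apply, Finset.sum_range_succ,
    Finset.sum_eq_single_of_mem ((i : ℕ) + 1) (Finset.mem_range.2 (by omega))]
  · simp only [Pi.smul_apply, altPoint, if_neg (show ¬ ((i : ℕ) + 1 = n + 1) by omega), if_true,
      smul_eq_mul, altChoose_last, Pi.zero_apply]
    have : ((-1 : ℤ)) ^ (n + 1) * ((-1) ^ n) = -1 := by
      rw [← pow_add, show n + 1 + n = 2 * n + 1 by omega]
      simp [pow_succ, pow_mul]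
    linear_combination altChoose n (i + 1) * this
  · intro k hk hne
    have := Finset.mem_range.1 hk
    rw [Pi.smul_apply, altPoint, if_neg (by omega), if_neg hne, smul_zero]

theorem altPoint_last_apply (i : Fin n) :
    altPoint n (n + 1) i ≠ 0 ∧ altPoint n (n + 1) i ≠ 1 ∧
      0 ≤ ((n + 1).choose (i + 1) : ℤ) + altPoint n (n + 1) i := by
  have h : altPoint n (n + 1) i = (n + 1).choose (i + 1) ∨
      altPoint n (n + 1) i = -(n + 1).choose (i + 1) := by
    rw [altPoint, if_pos rfl, altChoose, ← mul_assoc, ← pow_add]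
    rcases neg_one_pow_eq_or ℤ (n + (i + 1)) with h | h <;> simp [h]
  have := two_le_choose i.2
  omega

theorem altPoint_injOn (hn : 1 ≤ n) : Set.InjOn (altPoint n) (Finset.range (n + 2)) := by
  have key : ∀ k l, k < l → l < n + 2 → altPoint n k ≠ altPoint n l := by
    intro k l hkl hl h
    by_cases hl' : l = n + 1
    · subst hl'
      have h1 := congrFun h ⟨0, hn⟩
      have h2 := altPoint_last_apply (⟨0, hn⟩ : Fin n)
      rw [← h1, altPoint, if_neg (by omega)] at h2
      split_ifs at h2 <;> simp at h2
    · obtain ⟨i, rfl⟩ : ∃ i, l = i + 1 := ⟨l - 1, by omega⟩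
      have h1 := congrFun h ⟨i, by omega⟩
      rw [altPoint, altPoint, if_neg (by omega), if_neg (by simpa using hkl.ne), if_neg hl',
        if_pos rfl] at h1
      exact zero_ne_one h1
  intro k hk l hl h
  have hk' := Finset.mem_range.1 (Finset.mem_coe.1 hk)
  have hl' := Finset.mem_range.1 (Finset.mem_coe.1 hl)
  rcases lt_trichotomy k l with h1 | h1 | h1
  · exact absurd h (key k l h1 hl')
  · exact h1
  · exact absurd h.symm (key l k h1 hk')

/-- A translation vector making all points `altPoint n k` nonnegative. -/
def altShift (n : ℕ) : Fin n → ℤ := fun i => (n + 1).choose (i + 1)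

/-- The support of the extremal system. -/
def altSupport (n : ℕ) : Finset (Fin n → ℤ) :=
  (Finset.range (n + 2)).image fun k => altShift n + altPoint n k

theorem card_altSupport (hn : 1 ≤ n) : (altSupport n).card = n + 2 := by
  rw [altSupport, Finset.card_image_of_injOn, Finset.card_range]
  exact fun k hk l hl h => altPoint_injOn hn hk hl (add_left_cancel h)

theorem altSupport_nonneg : ∀ a ∈ altSupport n, ∀ i, 0 ≤ a i := by
  intro a ha i
  obtain ⟨k, -, rfl⟩ := Finset.mem_image.1 ha
  rw [Pi.add_apply, altShift]
  by_cases hk : k = n + 1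
  · exact hk ▸ (altPoint_last_apply i).2.2
  · rw [altPoint, if_neg hk]
    split_ifs <;> positivity

/-- All coefficients of the affine relation are nonzero. An affine function that vanishes at all
points but one thus vanishes at the last too, and vanishing at the translates of `0` and all `e_i`
kills its linear part. -/
theorem noPointsInHyperplane_altSupport (hn : 1 ≤ n) : NoPointsInHyperplane (altSupport n) := by
  rintro S hS hcard ⟨c, δ, hc, hδ⟩
  have hex : ∃ k₀, ∀ k ∈ Finset.range (n + 2), k ≠ k₀ → altShift n + altPoint n k ∈ S := by
    have h1 : (altSupport n \ S).card = 1 := by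
      rw [Finset.card_sdiff_of_subset hS, card_altSupport hn, hcard]
      omega
    obtain ⟨x, hx⟩ := Finset.card_eq_one.1 h1
    have hxA : x ∈ altSupport n := (Finset.mem_sdiff.1 (hx ▸ Finset.mem_singleton_self x)).1
    obtain ⟨k₀, hk₀, rfl⟩ := Finset.mem_image.1 hxA
    refine ⟨k₀, fun k hk hne => ?_⟩
    by_contra hkS
    have : altShift n + altPoint n k ∈ altSupport n \ S :=
      Finset.mem_sdiff.2 ⟨Finset.mem_image_of_mem _ hk, hkS⟩
    rw [hx, Finset.mem_singleton] at this
    exact hne (altPoint_injOn hn hk hk₀ (add_left_cancel this))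
  obtain ⟨k₀, hk₀⟩ := hex
  let g : ℕ → ℝ := fun k => ∑ i, c i * ((altShift n + altPoint n k) i : ℝ) - δ
  have hg : ∀ k ∈ Finset.range (n + 2), k ≠ k₀ → g k = 0 := fun k hk hne =>
    sub_eq_zero.2 (hδ _ (hk₀ k hk hne))
  have hsum0 : ∑ k ∈ Finset.range (n + 2), (altChoose n k : ℝ) = 0 := by
    have := sum_altChoose_mul_pow n 0 (by omega)
    simp only [pow_zero, mul_one] at this
    exact_mod_cast this
  have hsum : ∑ k ∈ Finset.range (n + 2), (altChoose n k : ℝ) * g k = 0 := by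
    have h1 : ∀ i, ∑ k ∈ Finset.range (n + 2), (altChoose n k : ℝ) * (altPoint n k i : ℝ) = 0 := by
      intro i
      have := congrFun (sum_altChoose_smul_altPoint (n := n)) i
      rw [Finset.sum_apply] at this
      simp only [Pi.smul_apply, smul_eq_mul, Pi.zero_apply] at this
      exact_mod_cast this
    have h2 : ∀ k, (altChoose n k : ℝ) * g k =
        (∑ i, c i * ((altChoose n k : ℝ) * (altPoint n k i : ℝ))) +
          (altChoose n k : ℝ) * (∑ i, c i * (altShift n i : ℝ) - δ) := by
      intro k
      simp only [g, Pi.add_apply, Int.cast_add, mul_add, Finset.sum_add_distrib]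
      have : ∑ i, c i * ((altChoose n k : ℝ) * (altPoint n k i : ℝ)) =
          (altChoose n k : ℝ) * ∑ i, c i * (altPoint n k i : ℝ) := by
        rw [Finset.mul_sum]
        exact Finset.sum_congr rfl fun i _ => by ring
      rw [this]
      ring
    simp_rw [h2, Finset.sum_add_distrib, ← Finset.sum_mul]
    rw [hsum0, zero_mul, add_zero, Finset.sum_comm]
    simp_rw [← Finset.mul_sum, h1, mul_zero, Finset.sum_const_zero]
  have hgall : ∀ k ∈ Finset.range (n + 2), g k = 0 := by
    intro k hk
    by_cases hne : k = k₀
    · subst hne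
      rw [Finset.sum_eq_single_of_mem k hk fun l hl hlk => by rw [hg l hl hlk, mul_zero]] at hsum
      exact (mul_eq_zero.1 hsum).resolve_left
        (by exact_mod_cast altChoose_ne_zero (Finset.mem_range.1 hk))
    · exact hg k hk hne
  refine hc (funext fun i => ?_)
  have hi := i.2
  have h1 := hgall (i + 1) (Finset.mem_range.2 (by omega))
  have h0 := hgall 0 (Finset.mem_range.2 (by omega))
  simp only [g, altPoint_zero, altPoint_succ, Pi.add_apply, Pi.zero_apply, Int.cast_add, mul_add,
    Finset.sum_add_distrib, Int.cast_zero, mul_zero, Finset.sum_const_zero, add_zero] at h0 h1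
  rw [Finset.sum_eq_single_of_mem (f := fun j => c j * ((Pi.single i 1 : Fin n → ℤ) j : ℝ)) i
    (Finset.mem_univ i) fun j _ hj => by simp [Pi.single_eq_of_ne hj]] at h1
  simp only [Pi.single_eq_same, Int.cast_one, mul_one] at h1
  simpa using (by linarith : c i = 0)

/-- The extremal system: in the coordinates `y_k = x ^ altPoint n k`, it says that
`y_k = 1 + k (y_1 - 1)` for `2 ≤ k ≤ n + 1`. -/
noncomputable def altSystem (K : Type*) [Field K] (n : ℕ) (i : Fin n) : LaurentRing K n :=
  AddMonoidAlgebra.single (altShift n + altPoint n (i + 2)) 1 +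
    (AddMonoidAlgebra.single (altShift n + altPoint n 1) (-((i : ℕ) + 2 : K)) +
      AddMonoidAlgebra.single (altShift n + altPoint n 0) ((i : ℕ) + 1 : K))

theorem support_altSystem (i : Fin n) : (altSystem K n i).coeff.support ⊆ altSupport n := by
  classical
  have key : ∀ k < n + 2, ∀ c : K, (AddMonoidAlgebra.single (altShift n + altPoint n k) c :
      LaurentRing K n).coeff.support ⊆ altSupport n := by
    intro k hk c
    rw [AddMonoidAlgebra.coeff_single]
    refine Finsupp.support_single_subset.trans (Finset.singleton_subset_iff.2 ?_)
    exact Finset.mem_image_of_mem _ (Finset.mem_range.2 hk)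
  have := i.2
  rw [altSystem, AddMonoidAlgebra.coeff_add, AddMonoidAlgebra.coeff_add]
  exact Finsupp.support_add.trans (Finset.union_subset (key _ (by omega) _)
    (Finsupp.support_add.trans (Finset.union_subset (key _ (by omega) _) (key _ (by omega) _))))

theorem laurentAlgHom_altSystem {B : Type*} [CommRing B] [Algebra K B]
    (φ : LaurentRing K n →ₐ[K] B) (i : Fin n) :
    φ (altSystem K n i) = φ (AddMonoidAlgebra.single (altShift n) 1) *
      (φ (AddMonoidAlgebra.single (altPoint n (i + 2)) 1) -
        (1 + ((i + 2 : ℕ) : B) * (φ (AddMonoidAlgebra.single (altPoint n 1) 1) - 1))) := by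
  have h : ∀ (a : Fin n → ℤ) (c : K), φ (AddMonoidAlgebra.single (altShift n + a) c) =
      φ (AddMonoidAlgebra.single (altShift n) 1) *
        (algebraMap K B c * φ (AddMonoidAlgebra.single a 1)) := by
    intro a c
    rw [← Algebra.smul_def, ← map_smul, ← map_mul, AddMonoidAlgebra.smul_single,
      AddMonoidAlgebra.single_mul_single]
    simp
  rw [altSystem, map_add, map_add, h, h, h, altPoint_zero, ← AddMonoidAlgebra.one_def, map_one φ]
  simp only [map_one, map_neg, map_add, map_natCast, map_ofNat]
  push_cast
  ring

theorem isUnit_laurentAlgHom_single {B : Type*} [CommRing B] [Algebra K B]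
    (φ : LaurentRing K n →ₐ[K] B) (a : Fin n → ℤ) :
    IsUnit (φ (AddMonoidAlgebra.single a 1)) :=
  (laurentUnit K (.ofAdd a)).isUnit.map φ

theorem prod_zpow_altPoint {G : Type*} [CommGroup G] (χ : Multiplicative (Fin n → ℤ) →* G) :
    ∏ k ∈ Finset.range (n + 2), χ (.ofAdd (altPoint n k)) ^ altChoose n k = 1 := by
  simp_rw [← map_zpow, ← ofAdd_zsmul, ← map_prod, ← ofAdd_sum]
  rw [sum_altChoose_smul_altPoint, ofAdd_zero, map_one]

/-- A zero is determined by `x_1 - 1`, which the relation between the exponents makes a root of the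
nonzero polynomial `altPoly`. -/
theorem finite_torusZeros_altSystem [CharZero K] :
    (torusZeros (altSystem K n)).Finite := by
  have hy : ∀ ξ ∈ torusZeros (altSystem K n), ∀ k < n + 2,
      (torusPow ξ (.ofAdd (altPoint n k)) : K) =
        1 + k * ((torusPow ξ (.ofAdd (altPoint n 1)) : K) - 1) := by
    intro ξ hξ k hk
    rcases k with _ | _ | k
    · simp [altPoint_zero]
    · simp
    · have h := hξ ⟨k, by omega⟩
      rw [laurentAlgHom_altSystem] at h
      have h1 := sub_eq_zero.1 ((mul_eq_zero.1 h).resolve_left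
        (isUnit_laurentAlgHom_single (laurentEval ξ) (altShift n)).ne_zero)
      simpa [laurentEval_single_eq_torusPow, add_assoc, one_add_one_eq_two] using h1
  refine Set.Finite.of_injOn (t := {w | (altPoly K n).IsRoot w})
    (f := fun ξ => (torusPow ξ (.ofAdd (altPoint n 1)) : K) - 1) (fun ξ hξ => ?_)
    (fun ξ hξ ξ' hξ' heq => ?_) (Polynomial.finite_setOfPred_isRoot (altPoly_ne_zero K n))
  · have h1 := congrArg Units.val
      ((prod_zpow_eq_one_iff _ _ _).1 (prod_zpow_altPoint (torusPow ξ)))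
    push_cast at h1
    change eval _ (altPoly K n) = 0
    rw [altPoly, linearFormsBinomial, eval_sub, sub_eq_zero, eval_prod, eval_prod]
    convert h1 using 1
    all_goals
      refine Finset.prod_congr rfl fun k hk => ?_
      rw [hy ξ hξ k (Finset.mem_range.1 hk)]
      simp
  · funext i
    have h : ∀ η : Fin n → Kˣ, torusPow η (.ofAdd (altPoint n (i + 1))) = η i := by
      intro η
      rw [altPoint_succ]
      change ∏ j, η j ^ (Pi.single i 1 : Fin n → ℤ) j = η i
      rw [Finset.prod_eq_single_of_mem i (Finset.mem_univ i)
        fun j _ hj => by simp [Pi.single_eq_of_ne hj]]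
      simp
    have hi := i.2
    rw [← h ξ, ← h ξ']
    refine Units.ext ?_
    simp only at heq
    rw [hy ξ hξ _ (by omega), hy ξ' hξ' _ (by omega), heq]

theorem one_mem_torusZeros_altSystem : (1 : Fin n → Kˣ) ∈ torusZeros (altSystem K n) := by
  intro i
  rw [laurentAlgHom_altSystem]
  simp [laurentEval_single_eq_torusPow, torusPow]

end SharpSystem

/-! ### The jet that gives the lower bound `n + 1`. -/

section Sharpness

open Polynomial

variable {K : Type*} [Field K] {n : ℕ}

theorem isUnit_adjoinRoot_mk {k : ℕ} {p : K[X]} (hp : p.eval 0 ≠ 0) :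
    IsUnit (AdjoinRoot.mk ((X : K[X]) ^ k) p) := by
  obtain ⟨a, b, h⟩ := isCoprime_X_of_eval_zero_ne_zero hp k
  refine IsUnit.of_mul_eq_one (AdjoinRoot.mk _ b) ?_
  rw [← map_mul, ← map_one (AdjoinRoot.mk ((X : K[X]) ^ k)), ← h, map_add, map_mul _ a,
    AdjoinRoot.mk_self, mul_zero, zero_add, mul_comm]

/-- An infinitesimal curve through `1` on which the extremal system vanishes to order `n`. -/
theorem exists_jet_altSystem [CharZero K] (hn : 1 ≤ n) :
    ∃ ψ : LaurentRing K n →ₐ[K] AdjoinRoot ((X : K[X]) ^ (n + 1)),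
      (∀ f, laurentEval 1 f ≠ 0 → IsUnit (ψ f)) ∧ (∀ i, ψ (altSystem K n i) = 0) ∧
      ψ (AddMonoidAlgebra.single (altPoint n 1) 1) = 1 + AdjoinRoot.root _ := by
  have hunit : ∀ k : ℕ, IsUnit (AdjoinRoot.mk ((X : K[X]) ^ (n + 1)) (1 + C (k : K) * X)) :=
    fun k => isUnit_adjoinRoot_mk (by simp)
  let y : ℕ → (AdjoinRoot ((X : K[X]) ^ (n + 1)))ˣ := fun k => (hunit k).unit
  have hy : ∀ k, (y k : AdjoinRoot ((X : K[X]) ^ (n + 1))) =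
      AdjoinRoot.mk _ (1 + C (k : K) * X) := fun k => (hunit k).unit_spec
  let ψ : LaurentRing K n →ₐ[K] AdjoinRoot ((X : K[X]) ^ (n + 1)) :=
    laurentLift K fun i => y (i + 1)
  let χ : Multiplicative (Fin n → ℤ) →* (AdjoinRoot ((X : K[X]) ^ (n + 1)))ˣ :=
    (Units.map (ψ : LaurentRing K n →* AdjoinRoot ((X : K[X]) ^ (n + 1)))).comp (laurentUnit K)
  have hχψ : ∀ a : Fin n → ℤ, ψ (AddMonoidAlgebra.single a 1) = χ (.ofAdd a) := fun a => rfl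
  have hχ : ∀ k < n + 1, χ (.ofAdd (altPoint n k)) = y k := by
    intro k hk
    rcases k with _ | k
    · rw [altPoint_zero, ofAdd_zero, map_one]
      refine Units.ext ?_
      rw [hy]
      simp
    · refine Units.ext ?_
      rw [← hχψ, altPoint_succ (⟨k, by omega⟩ : Fin n)]
      exact laurentLift_coord _ (⟨k, by omega⟩ : Fin n)
  -- Divisibility of `altPoly` by `X ^ (n + 1)` is exactly this multiplicative relation in the
  -- truncated ring.
  have hprod : ∏ k ∈ Finset.range (n + 2), y k ^ altChoose n k = 1 := by
    rw [prod_zpow_eq_one_iff]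
    refine Units.ext ?_
    push_cast
    simp_rw [hy, ← map_pow, ← map_prod]
    rw [← sub_eq_zero, ← map_sub, AdjoinRoot.mk_eq_zero]
    exact X_pow_dvd_altPoly K n
  -- The last exponent in the relation is `±1`, so the other values determine the last one.
  have hlast : χ (.ofAdd (altPoint n (n + 1))) = y (n + 1) := by
    have h1 := prod_zpow_altPoint χ
    rw [← hprod, Finset.prod_range_succ, Finset.prod_range_succ (fun k => y k ^ altChoose n k),
      Finset.prod_congr rfl fun k hk => congrArg (· ^ altChoose n k)
        (hχ k (Finset.mem_range.1 hk))] at h1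
    have h2 := mul_left_cancel h1
    rw [altChoose_last] at h2
    rcases neg_one_pow_eq_or ℤ (n + 1) with h | h
    · simpa [h] using h2
    · simpa [h] using h2
  have hall : ∀ k < n + 2, χ (.ofAdd (altPoint n k)) = y k := by
    intro k hk
    by_cases h : k = n + 1
    · rw [h, hlast]
    · exact hχ k (by omega)
  have h1 : ψ (AddMonoidAlgebra.single (altPoint n 1) 1) = 1 + AdjoinRoot.root _ := by
    rw [hχψ, hall 1 (by omega), hy]
    simp
  refine ⟨ψ, fun f hf => ?_, fun i => ?_, h1⟩
  -- Setting `X = 0` turns the jet into evaluation at `1`, so a function nonzero there maps to a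
  -- unit.
  · let aug : AdjoinRoot ((X : K[X]) ^ (n + 1)) →ₐ[K] K :=
      AdjoinRoot.liftAlgHom _ (Algebra.ofId K K) 0 (by simp)
    have haug : ∀ p, aug (AdjoinRoot.mk _ p) = p.eval 0 := fun p => by
      rw [AdjoinRoot.liftAlgHom_mk]
      rfl
    have hcomp : aug.comp ψ = laurentEval 1 := by
      refine laurentAlgHom_ext fun i => ?_
      rw [laurentEval_coord, AlgHom.comp_apply, laurentLift_coord, hy, haug]
      simp
    obtain ⟨p, hp⟩ := AdjoinRoot.mk_surjective (ψ f)
    rw [← hcomp, AlgHom.comp_apply, ← hp, haug] at hf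
    rw [← hp]
    exact isUnit_adjoinRoot_mk hf
  · have := i.2
    rw [laurentAlgHom_altSystem, h1, hχψ (altPoint n _), hall _ (by omega), hy]
    simp only [map_add, map_one, map_mul, AdjoinRoot.mk_X, map_natCast]
    ring

theorem le_intersectionMultiplicity_altSystem [CharZero K] (hn : 1 ≤ n) :
    (n + 1 : ℕ∞) ≤ intersectionMultiplicity (altSystem K n) 1 := by
  obtain ⟨ψ, hunit, hF, h1⟩ := exists_jet_altSystem (K := K) hn
  obtain ⟨Ψ, hΨ⟩ := exists_localQuotient_lift (altSystem K n) 1 ψ hunit hF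
  have hmonic : ((X : K[X]) ^ (n + 1)).Monic := monic_X_pow _
  have := hmonic.finite_adjoinRoot
  -- The class of `X`, which generates the truncated ring, is the image of `x_1 - 1`.
  have hsurj : Function.Surjective Ψ := by
    rw [← AlgHom.range_eq_top, eq_top_iff, ← AdjoinRoot.adjoinRoot_eq_top, Algebra.adjoin_le_iff,
      Set.singleton_subset_iff]
    refine ⟨toLocalQuotient _ _ (AddMonoidAlgebra.single (altPoint n 1) 1 - 1), ?_⟩
    exact (hΨ _).trans (by rw [map_sub, h1, map_one, add_sub_cancel_left])
  have h := le_intersectionMultiplicity_of_surjective _ _ Ψ hsurj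
  have h2 : Module.finrank K (AdjoinRoot ((X : K[X]) ^ (n + 1))) = n + 1 := by
    rw [(AdjoinRoot.powerBasis' hmonic).finrank, AdjoinRoot.powerBasis'_dim, natDegree_X_pow]
  rw [h2] at h
  exact_mod_cast h

end Sharpness

/-! ### The example with `n + 1` points. -/

section StandardSimplex

variable {K : Type*} [Field K] {n : ℕ}

/-- The vertices of the standard simplex. -/
def simplexSupport (n : ℕ) : Finset (Fin n → ℤ) :=
  insert 0 (Finset.univ.image fun i => Pi.single i 1)

theorem card_simplexSupport : (simplexSupport n).card = n + 1 := by
  rw [simplexSupport, Finset.card_insert_of_notMem, Finset.card_image_of_injective]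
  · simp
  · intro i j h
    by_contra hne
    have := congrFun h i
    simp [Pi.single_eq_of_ne hne] at this
  · simp

theorem noPointsInHyperplane_simplexSupport : NoPointsInHyperplane (simplexSupport n) := by
  rintro S hS hcard ⟨c, δ, hc, hδ⟩
  have hSA : S = simplexSupport n :=
    Finset.eq_of_subset_of_card_le hS (by rw [card_simplexSupport, hcard])
  subst hSA
  have h0 := hδ 0 (Finset.mem_insert_self _ _)
  simp only [Pi.zero_apply, Int.cast_zero, mul_zero, Finset.sum_const_zero] at h0
  refine hc (funext fun i => ?_)
  have h1 := hδ (Pi.single i 1)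
    (Finset.mem_insert_of_mem (Finset.mem_image_of_mem _ (Finset.mem_univ i)))
  rw [Finset.sum_eq_single_of_mem i (Finset.mem_univ i)
    fun j _ hj => by simp [Pi.single_eq_of_ne hj]] at h1
  simpa [← h0] using h1

/-- The system `x₁ = 1, …, xₙ = 1`. -/
noncomputable def simplexSystem (K : Type*) [Field K] (n : ℕ) (i : Fin n) : LaurentRing K n :=
  AddMonoidAlgebra.single (Pi.single i 1) 1 + AddMonoidAlgebra.single 0 (-1)

theorem support_simplexSystem (i : Fin n) :
    (simplexSystem K n i).coeff.support ⊆ simplexSupport n := by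
  classical
  rw [simplexSystem, AddMonoidAlgebra.coeff_add]
  refine Finsupp.support_add.trans (Finset.union_subset ?_ ?_) <;>
    refine Finsupp.support_single_subset.trans (Finset.singleton_subset_iff.2 ?_)
  · exact Finset.mem_insert_of_mem (Finset.mem_image_of_mem _ (Finset.mem_univ i))
  · exact Finset.mem_insert_self _ _

theorem torusZeros_simplexSystem : torusZeros (simplexSystem K n) = {1} := by
  have h : ∀ (ξ : Fin n → Kˣ) i, laurentEval ξ (simplexSystem K n i) = ξ i - 1 := by
    intro ξ i
    have h1 := laurentEval_coord ξ i
    rw [laurentCoord, coe_laurentUnit, toAdd_ofAdd] at h1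
    rw [simplexSystem, map_add, h1, laurentEval_single]
    simp [sub_eq_add_neg]
  ext ξ
  refine ⟨fun hξ => funext fun i => Units.ext ?_, fun hξ i => ?_⟩
  · have := hξ i
    rw [h, sub_eq_zero] at this
    exact this
  · rw [h, Set.mem_singleton_iff.1 hξ]
    simp

end StandardSimplex

/-! ### Bounds and sharpness combined. -/

theorem theorem1p8 (K : Type*) [Field K] [IsAlgClosed K] [CharZero K] (n : ℕ) (hn : 1 ≤ n) :
    -- the upper bounds
    (∀ (A : Finset (Fin n → ℤ)) (F : Fin n → LaurentRing K n),
      A.card ≤ n + 2 → NoPointsInHyperplane A →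
      (∀ i, (F i).coeff.support ⊆ A) → (torusZeros F).Finite →
      ∀ ζ ∈ torusZeros F,
        (A.card = n + 2 → intersectionMultiplicity F ζ ≤ n + 1) ∧
        (A.card = n + 1 → intersectionMultiplicity F ζ = 1)) ∧
    -- sharpness for `n + 2` points, with genuine polynomials
    (∃ (A : Finset (Fin n → ℤ)) (F : Fin n → LaurentRing K n),
      A.card = n + 2 ∧ NoPointsInHyperplane A ∧ (∀ a ∈ A, ∀ i, 0 ≤ a i) ∧
      (∀ i, (F i).coeff.support ⊆ A) ∧ (torusZeros F).Finite ∧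
      ∃ ζ ∈ torusZeros F, intersectionMultiplicity F ζ = n + 1) ∧
    -- sharpness for `n + 1` points, with genuine polynomials
    (∃ (A : Finset (Fin n → ℤ)) (F : Fin n → LaurentRing K n),
      A.card = n + 1 ∧ NoPointsInHyperplane A ∧ (∀ a ∈ A, ∀ i, 0 ≤ a i) ∧
      (∀ i, (F i).coeff.support ⊆ A) ∧ (torusZeros F).Finite ∧
      ∃ ζ ∈ torusZeros F, intersectionMultiplicity F ζ = 1) := by
  refine ⟨fun A F hcard hA hF hfin ζ hζ => ⟨fun h => ?_, fun h => ?_⟩,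
    ⟨altSupport n, altSystem K n, card_altSupport hn, noPointsInHyperplane_altSupport hn,
      altSupport_nonneg, support_altSystem, finite_torusZeros_altSystem, 1,
      one_mem_torusZeros_altSystem, le_antisymm ?_ (le_intersectionMultiplicity_altSystem hn)⟩,
    ⟨simplexSupport n, simplexSystem K n, card_simplexSupport,
      noPointsInHyperplane_simplexSupport, fun a ha i => ?_, support_simplexSystem, ?_, 1, ?_, ?_⟩⟩
  · exact (intersectionMultiplicity_bounds A F (by omega) hcard hA hF hfin ζ hζ).1
  · exact (intersectionMultiplicity_bounds A F (by omega) hcard hA hF hfin ζ hζ).2 h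
  · exact (intersectionMultiplicity_bounds (altSupport n) (altSystem K n)
      (by rw [card_altSupport hn]; omega) (card_altSupport hn).le
      (noPointsInHyperplane_altSupport hn) support_altSystem (finite_torusZeros_altSystem) 1
      one_mem_torusZeros_altSystem).1
  · rcases Finset.mem_insert.1 ha with rfl | ha
    · exact le_rfl
    · obtain ⟨j, -, rfl⟩ := Finset.mem_image.1 ha
      rw [Pi.single_apply]
      split_ifs <;> norm_num
  · rw [torusZeros_simplexSystem]
    exact Set.finite_singleton _
  · rw [torusZeros_simplexSystem]
    exact Set.mem_singleton _
  · exact (intersectionMultiplicity_bounds (simplexSupport n) (simplexSystem K n)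
      card_simplexSupport.ge (by rw [card_simplexSupport]; omega)
      noPointsInHyperplane_simplexSupport support_simplexSystem
      (by rw [torusZeros_simplexSystem]; exact Set.finite_singleton _) 1
      (by rw [torusZeros_simplexSystem]; exact Set.mem_singleton _)).2 card_simplexSupport
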